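/- For a finite simple graph $G=(V,E)$ and a set of terminals $W\subseteq V$, a set $X\subseteq V$ is an induced Steiner subgraph of $(G,W)$ if $W\subseteq X$ and any two terminals are joined by a path in $G[X]$; it is minimal if no proper subset of $X$ is one. $G$ is claw-free if it has no induced subgraph isomorphic to $K_{1,3}$. For $U\subseteq V$ let $N(U)$ be the set of vertices outside $U$ with a neighbor in $U$. **Theorem.** (a) *Enumeration.* There are an algorithm and polynomials $p,q$ such that, for every claw-free graph $G$ with $n$ vertices and every $W\subseteq V(G)$, the algorithm, given $(G,W)$ (adjacency matrix and characteristic vector), halts after having output every minimal induced Steiner subgraph of $(G,W)$ exactly once and nothing else. The time before the first output, between any two consecutive outputs, and after the last output is at most $p(n)$ (polynomial delay), and the algorithm uses at most $2^n q(n)$ memory cells (exponential space). The machine model is a linked memory of two-pointer cells with a fixed finite set of pointer variables: following, copying or testing a pointer, or allocating a cell, takes one unit of time, and writing an output takes time proportional to its length. (b) *Strong connectivity of the solution graph.* Let $G=(V,E)$ be a finite claw-free graph and $W\subseteq V$. Let $\mu$ be any procedure that, for each connected vertex set $U$ and each $T\subseteq U$, returns a minimal induced Steiner subgraph $\mu(U,T)\subseteq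 U$ of $(G,T)$. The solution graph $\mathcal G$ has the minimal induced Steiner subgraphs of $(G,W)$ as nodes, and its arcs $X\to Z$ are defined as follows. Let $v\in X\setminus W$, let $C_1,C_2$ be the two connected components of $G[X\setminus\{v\}]$, in either order, and let $w\in N(C_1)\setminus\{v\}$. Put $C_1^w=\mu(C_1\cup\{w\},(W\cap C_1)\cup\{w\})$ and $C_2^w=\mu(C_2,W\cap C_2)$. Let $P$ be an arbitrarily chosen shortest one among the paths from $w$ to $N(C_2^w)$ that avoid $v$ and avoid $N(C_1^w\setminus\{w\})\setminus\{w\}$. If such a path exists, then $Z=\mu(C_1^w\cup C_2^w\cup V(P),W)$ is a neighbor of $X$ with respect to $(v,w)$, and $X\to Z$ is an arc. Then, for every choice of $\mu$ and of the shortest paths $P$: for any two distinct minimal induced Steiner subgraphs $X,Y$ of $(G,W)$ there is a directed path in $\mathcal G$ from $X$ to a minimal induced Steiner subgraph $Z$ of $(G,W)$ with $|Z\setminus Y|<|X\setminus Y|$. Consequently, $\mathcal G$ is strongly connected. -/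

import Mathlib

namespace SteinerEnum

/-! ### Minimal induced Steiner subgraphs and claw-free graphs -/

section Graph

variable {V : Type*}

/-- `X` induces a Steiner subgraph of `(G, W)`: the graph `G[X]` contains all terminals, and any two
terminals are joined by a path in `G[X]`. -/
def IsInducedSteiner (G : SimpleGraph V) (W X : Set V) : Prop :=
  ∃ h : W ⊆ X, ∀ a b : W, (G.induce X).Reachable ⟨a, h a.2⟩ ⟨b, h b.2⟩

/-- Inclusion-wise minimal induced Steiner subgraphs, identified with their vertex sets. -/
def IsMinimalInducedSteiner (G : SimpleGraph V) (W X : Set V) : Prop :=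
  Minimal (IsInducedSteiner G W) X

/-- `G` has no induced subgraph isomorphic to the star `K_{1,3}`. -/
def ClawFree (G : SimpleGraph V) : Prop :=
  ¬ (completeBipartiteGraph (Fin 1) (Fin 3)).IsIndContained G

/-! ### The solution graph -/

/-- The open neighbourhood `N(U)` of a vertex set. -/
def nbhd (G : SimpleGraph V) (U : Set V) : Set V :=
  {x | x ∉ U ∧ ∃ u ∈ U, G.Adj u x}

/-- `C` is the vertex set of a connected component of `G[U]`. -/
def IsComponentOf (G : SimpleGraph V) (U C : Set V) : Prop :=
  ∃ c : (G.induce U).ConnectedComponent, C = Subtype.val '' c.supp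

/-- `μ` is a procedure that, for every connected vertex set `U` and all terminals `T ⊆ U`, returns
some minimal induced Steiner subgraph of `(G, T)` contained in `U`. -/
def IsMinimizer (G : SimpleGraph V) (μ : Set V → Set V → Set V) : Prop :=
  ∀ U T : Set V, T ⊆ U → (G.induce U).Connected →
    μ U T ⊆ U ∧ IsMinimalInducedSteiner G T (μ U T)

/-- `p` is a path from `w` to `N(B)` that avoids `v` and, apart from its first vertex `w`, also
avoids `N(A \ {w})`. -/
def IsAdmissible (G : SimpleGraph V) (A B : Set V) (v w : V) {u : V} (p : G.Walk w u) : Prop :=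
  p.IsPath ∧ u ∈ nbhd G B ∧ v ∉ p.support ∧
    ∀ x ∈ p.support, x ≠ w → x ∉ nbhd G (A \ {w})

/-- The vertex sets of the shortest admissible paths. -/
def shortestPathSets (G : SimpleGraph V) (A B : Set V) (v w : V) : Set (Set V) :=
  {S | ∃ (u : V) (p : G.Walk w u), IsAdmissible G A B v w p ∧
    (∀ (u' : V) (q : G.Walk w u'), IsAdmissible G A B v w q → p.length ≤ q.length) ∧
    S = {x | x ∈ p.support}}

/-- `C₁^w`: a minimal connection, inside `C₁ ∪ {w}`, of `w` and the terminals of `C₁`. -/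
def side₁ (W : Set V) (μ : Set V → Set V → Set V) (C₁ : Set V) (w : V) : Set V :=
  μ (C₁ ∪ {w}) ((W ∩ C₁) ∪ {w})

/-- `C₂^w`: a minimal connection, inside `C₂`, of the terminals of `C₂`. -/
def side₂ (W : Set V) (μ : Set V → Set V → Set V) (C₂ : Set V) : Set V :=
  μ C₂ (W ∩ C₂)

/-- `π X v C₁ C₂ w` is the vertex set of an arbitrary shortest admissible path, whenever there is
an admissible path. -/
def IsPathSelector (G : SimpleGraph V) (W : Set V) (μ : Set V → Set V → Set V)
    (π : Set V → V → Set V → Set V → V → Set V) : Prop :=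
  ∀ (X : Set V) (v : V) (C₁ C₂ : Set V) (w : V),
    (shortestPathSets G (side₁ W μ C₁ w) (side₂ W μ C₂) v w).Nonempty →
      π X v C₁ C₂ w ∈ shortestPathSets G (side₁ W μ C₁ w) (side₂ W μ C₂) v w

/-- `Z` is a neighbour of `X` with respect to `(v, w)`. Here `v` is a non-terminal of `X`, `C₁` and
`C₂` are the two components of `G[X \ {v}]`, in either order, and `w ∈ N(C₁) \ {v}`. There is no
neighbour for this choice if there is no admissible path. -/
def IsNeighbor (G : SimpleGraph V) (W : Set V) (μ : Set V → Set V → Set V)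
    (π : Set V → V → Set V → Set V → V → Set V) (v w : V) (X Z : Set V) : Prop :=
  v ∈ X \ W ∧ ∃ C₁ C₂ : Set V,
    IsComponentOf G (X \ {v}) C₁ ∧ IsComponentOf G (X \ {v}) C₂ ∧ C₁ ≠ C₂ ∧
    w ∈ nbhd G C₁ \ {v} ∧
    (shortestPathSets G (side₁ W μ C₁ w) (side₂ W μ C₂) v w).Nonempty ∧
    Z = μ (side₁ W μ C₁ w ∪ side₂ W μ C₂ ∪ π X v C₁ C₂ w) W

/-- The set of solutions, i.e. the nodes of the solution graph. -/
def Solution (G : SimpleGraph V) (W : Set V) : Type _ :=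
  {X : Set V // IsMinimalInducedSteiner G W X}

/-- The arcs of the solution graph. -/
def Arc (G : SimpleGraph V) (W : Set V) (μ : Set V → Set V → Set V)
    (π : Set V → V → Set V → Set V → V → Set V) (X Z : Solution G W) : Prop :=
  ∃ v w : V, IsNeighbor G W μ π v w X.1 Z.1

end Graph

/-! ### The machine model

While-programs over a linked memory of immutable two-pointer cells. A variable holds a pointer: either
`nil` or the address of a cell. Every instruction follows, copies or tests a single pointer, or
allocates a single cell, and takes one unit of time. Writing an output takes time proportional to
the length of what is written. -/

/-- What a pointer stands for: `nil`, or a cell with two pointers. -/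
inductive Data : Type
  | nil : Data
  | cons : Data → Data → Data

/-- Number of nodes of `d`, written out as a tree. -/
def Data.size : Data → ℕ
  | .nil => 1
  | .cons a b => a.size + b.size + 1

/-- Programs; variables are named by natural numbers. -/
inductive Prog : Type
  | skip : Prog
  | setNil (x : ℕ) : Prog
  | copy (x y : ℕ) : Prog
  | cons (x y z : ℕ) : Prog
  | fst (x y : ℕ) : Prog
  | snd (x y : ℕ) : Prog
  | emit (x : ℕ) : Prog
  | seq (c d : Prog) : Prog
  | ite (x : ℕ) (c d : Prog) : Prog
  | loop (x : ℕ) (c : Prog) : Prog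

def Data.fst : Data → Data
  | .nil => .nil
  | .cons a _ => a

def Data.snd : Data → Data
  | .nil => .nil
  | .cons _ b => b

/-- The contents of the variables. -/
abbrev Store := ℕ → Data

/-- The events of a run: a unit of time, a unit of time in which a new memory cell is allocated,
and the completion of an output. -/
inductive Event : Type
  | tick : Event
  | alloc : Event
  | out (d : Data) : Event

/-- `Exec c s tr s'`: started in the store `s`, the program `c` halts in the store `s'`, and `tr` is
the sequence of events of this run. -/
inductive Exec : Prog → Store → List Event → Store → Prop
  | skip (s : Store) : Exec .skip s [.tick] s
  | setNil (s : Store) (x : ℕ) : Exec (.setNil x) s [.tick] (Function.update s x .nil)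
  | copy (s : Store) (x y : ℕ) : Exec (.copy x y) s [.tick] (Function.update s x (s y))
  | cons (s : Store) (x y z : ℕ) :
      Exec (.cons x y z) s [.alloc] (Function.update s x (.cons (s y) (s z)))
  | fst (s : Store) (x y : ℕ) : Exec (.fst x y) s [.tick] (Function.update s x (s y).fst)
  | snd (s : Store) (x y : ℕ) : Exec (.snd x y) s [.tick] (Function.update s x (s y).snd)
  | emit (s : Store) (x : ℕ) :
      Exec (.emit x) s (List.replicate (s x).size .tick ++ [.out (s x)]) s
  | seq {c d : Prog} {s s' s'' : Store} {tr tr' : List Event} :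
      Exec c s tr s' → Exec d s' tr' s'' → Exec (.seq c d) s (tr ++ tr') s''
  | ite_true {x : ℕ} {c d : Prog} {s s' : Store} {tr : List Event} :
      s x ≠ .nil → Exec c s tr s' → Exec (.ite x c d) s (.tick :: tr) s'
  | ite_false {x : ℕ} {c d : Prog} {s s' : Store} {tr : List Event} :
      s x = .nil → Exec d s tr s' → Exec (.ite x c d) s (.tick :: tr) s'
  | loop_done {x : ℕ} {c : Prog} {s : Store} :
      s x = .nil → Exec (.loop x c) s [.tick] s
  | loop_step {x : ℕ} {c : Prog} {s s' s'' : Store} {tr tr' : List Event} :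
      s x ≠ .nil → Exec c s tr s' → Exec (.loop x c) s' tr' s'' →
      Exec (.loop x c) s (.tick :: (tr ++ tr')) s''

/-- The outputs of a run, in order. -/
def outputs (tr : List Event) : List Data :=
  tr.filterMap fun e => match e with
    | .out d => some d
    | _ => none

/-- The delay of a run is at most `D`: every contiguous part of the run in which no output is
completed takes at most `D` units of time. This bounds the time before the first output, the time
between two consecutive outputs, and the time after the last output. -/
def DelayAtMost (D : ℕ) (tr : List Event) : Prop :=
  ∀ a b c : List Event, tr = a ++ b ++ c → outputs b = [] → b.length ≤ D

/-- The number of memory cells allocated during a run; no cell is ever released. -/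
def allocations (tr : List Event) : ℕ :=
  tr.countP fun e => match e with
    | .alloc => true
    | _ => false

/-! ### Encoding of inputs and outputs -/

/-- Linked lists. -/
def Data.ofList : List Data → Data
  | [] => .nil
  | d :: l => .cons d (Data.ofList l)

open Classical in
/-- The truth value of a proposition, as a pointer that is `nil` if the proposition fails. -/
noncomputable def bit (p : Prop) : Data := if p then .cons .nil .nil else .nil

/-- The characteristic vector of a vertex set, as a linked list of `n` bits. -/
noncomputable def encodeSet {n : ℕ} (S : Set (Fin n)) : Data :=
  .ofList (List.ofFn fun i => bit (i ∈ S))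

/-- The adjacency matrix of a graph, as a linked list of rows. -/
noncomputable def encodeGraph {n : ℕ} (G : SimpleGraph (Fin n)) : Data :=
  .ofList (List.ofFn fun i => encodeSet {j | G.Adj i j})

/-- The initial store: variable `0` holds the graph, variable `1` holds the terminals. -/
noncomputable def inputStore {n : ℕ} (G : SimpleGraph (Fin n)) (W : Set (Fin n)) : Store :=
  fun x => if x = 0 then encodeGraph G else if x = 1 then encodeSet W else .nil

/-- The memory used by a run on the input `(G, W)`: the input and all cells allocated. -/
noncomputable def memoryUsed {n : ℕ} (G : SimpleGraph (Fin n)) (W : Set (Fin n))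
    (tr : List Event) : ℕ :=
  (encodeGraph G).size + (encodeSet W).size + allocations tr

/-- The program `prog`, run on `(G, W)`, halts after it has output every minimal induced Steiner
subgraph of `(G, W)` exactly once and nothing else; its delay is at most `D`, and it uses at most
`M` memory cells. -/
def EnumeratesWithin (prog : Prog) {n : ℕ} (G : SimpleGraph (Fin n)) (W : Set (Fin n))
    (D M : ℕ) : Prop :=
  ∃ (tr : List Event) (s : Store), Exec prog (inputStore G W) tr s ∧
    (outputs tr).Nodup ∧
    (∀ d : Data, d ∈ outputs tr ↔ ∃ X : Set (Fin n), IsMinimalInducedSteiner G W X ∧ d = encodeSet X) ∧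
    DelayAtMost D tr ∧ memoryUsed G W tr ≤ M

end SteinerEnum

/-!
**Strong connectivity.** Let `X` be a minimal induced Steiner subgraph of a claw-free graph, and let
`v ∈ X` be a non-terminal. A third component of `G[X \ {v}]` would make `v` the centre of a claw, so
`v` splits `X` into two parts `C` and `D` (`ClawFree.split`). Let `A` be a minimal connection of `w`
and the terminals of `C`, let `B` be one of the terminals of `D`, and let `p` be an induced path
from `w` whose last vertex is its only one next to `B`. The neighbours of that vertex in `B` form a
clique, again by claw-freeness, so the terminals in `B` cannot be connected better with the help of
`p`. Hence the glued set `A ∪ B ∪ p` is minimal as it stands (`Linked.minimal`); each vertex of `p`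
after `w` splits it along `p` (`Linked.split`), and the only minimal connection of the terminals on
the far side is still `B` (`Linked.right_unique`).

Given another solution `Y` and `v ∈ X \ Y`, take a path inside `Y` from `C` to `B`, and let `w` be
its last vertex next to `C`. Then `B` and `A \ {w}` are contained in `X \ {v}`, so progress is made
unless `p` leaves `Y`. If it does, remove the first vertex of `p` outside `Y` from the glued set.
The path inside `Y` now has a last exit from a larger set, with the same target `B`, so the part of
it that remains is shorter, and the argument can be repeated (`Reroutes.exists_reachable`). All this
needs only that some suitable induced path is chosen. So it applies to the shortest admissible paths
of the solution graph (`arc_reroutes`), and equally to paths that arise by deleting vertices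
greedily (`expands_reroutes`).

**Enumeration.** The program searches the second of these solution graphs. It keeps a stack of the
solutions that are still to be output and a binary tree of all solutions found so far. In each round
it outputs the top of the stack and records the new ones among its polynomially many neighbours. So
there is exactly one output per round, a round takes polynomial time, and since at most `2 ^ n`
rounds take place, the bound on the time yields the bound on the memory (`mainLoop_spec`,
`exists_enumeration`).

The work of a round is described in a small language of functions, `Fn`, in which a loop can only be
repeated as often as the graph has vertices. Running times are therefore polynomial by construction
(`Fn.runs`), and all that is left to prove about an expression is which function it denotes. The
predicate `Comp` says that such an expression exists; its closure properties (connectives,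
quantifiers over vertices, set comprehension, folds over the vertices) lead to `Comp.expand`.
-/

namespace SteinerEnum

/-! ### Joining vertices inside a vertex set -/

section Graph

variable {V : Type*} {G : SimpleGraph V}

/-- `a` and `b` lie in `X` and are joined by a path in `G[X]`. -/
def Joined (G : SimpleGraph V) (X : Set V) (a b : V) : Prop :=
  ∃ (ha : a ∈ X) (hb : b ∈ X), (G.induce X).Reachable ⟨a, ha⟩ ⟨b, hb⟩

/-- Any two vertices of `X` are joined in `G[X]`; the empty set is allowed. -/
def Joinable (G : SimpleGraph V) (X : Set V) : Prop :=
  ∀ a ∈ X, ∀ b ∈ X, Joined G X a b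

theorem Joined.refl {X : Set V} {a : V} (ha : a ∈ X) : Joined G X a a := ⟨ha, ha, .rfl⟩

theorem Joined.symm {X : Set V} {a b : V} (h : Joined G X a b) : Joined G X b a :=
  let ⟨ha, hb, h⟩ := h; ⟨hb, ha, h.symm⟩

theorem Joined.trans {X : Set V} {a b c : V} (h : Joined G X a b) (h' : Joined G X b c) :
    Joined G X a c :=
  let ⟨ha, _, h⟩ := h; let ⟨_, hc, h'⟩ := h'; ⟨ha, hc, h.trans h'⟩

theorem Joined.mono {X X' : Set V} (hX : X ⊆ X') {a b : V} (h : Joined G X a b) :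
    Joined G X' a b :=
  let ⟨ha, hb, h⟩ := h
  ⟨hX ha, hX hb, h.map (SimpleGraph.induceHomOfLE G hX).toHom⟩

theorem Joined.of_adj {X : Set V} {a b : V} (ha : a ∈ X) (hb : b ∈ X) (h : G.Adj a b) :
    Joined G X a b :=
  ⟨ha, hb, SimpleGraph.Adj.reachable (by simpa using h)⟩

theorem Joined.step {X : Set V} {a b c : V} (h : Joined G X a b) (hc : c ∈ X)
    (hbc : G.Adj b c) : Joined G X a c :=
  h.trans (.of_adj h.2.1 hc hbc)

/-- A set that contains `a` and is closed under stepping inside `X` contains everything joined to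
`a`. -/
theorem Joined.mem_of_closed {X S : Set V} {a b : V} (h : Joined G X a b) (ha : a ∈ S)
    (hS : ∀ x ∈ S, x ∈ X → ∀ y ∈ X, G.Adj x y → y ∈ S) : b ∈ S := by
  obtain ⟨ha', hb', ⟨p⟩⟩ := h
  have key : ∀ (x y : X) (_ : (G.induce X).Walk x y), x.1 ∈ S → y.1 ∈ S := by
    intro x y p
    induction p with
    | nil => exact id
    | @cons u v _ huv _ ih =>
      exact fun hu => ih (hS _ hu u.2 _ v.2 (by simpa using huv))
  exact key _ _ p ha

theorem Joined.of_walk {X : Set V} {a b : V} (p : G.Walk a b) (hp : ∀ x ∈ p.support, x ∈ X) :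
    Joined G X a b := by
  induction p with
  | nil => exact .refl (hp _ (by simp))
  | cons h q ih =>
    refine (Joined.of_adj (hp _ (by simp)) (hp _ (by simp)) h).trans (ih fun x hx => hp x ?_)
    simp [hx]

theorem Joined.exists_walk {X : Set V} {a b : V} (h : Joined G X a b) :
    ∃ p : G.Walk a b, ∀ x ∈ p.support, x ∈ X := by
  obtain ⟨ha, hb, ⟨p⟩⟩ := h
  refine ⟨p.map (SimpleGraph.Embedding.induce X).toHom, fun x hx => ?_⟩
  obtain ⟨y, _, rfl⟩ := List.mem_map.1 ((SimpleGraph.Walk.support_map _ p) ▸ hx)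
  exact y.2

theorem isInducedSteiner_iff {W X : Set V} :
    IsInducedSteiner G W X ↔ W ⊆ X ∧ ∀ a ∈ W, ∀ b ∈ W, Joined G X a b :=
  ⟨fun ⟨h, h'⟩ => ⟨h, fun a ha b hb => ⟨h ha, h hb, h' ⟨a, ha⟩ ⟨b, hb⟩⟩⟩,
    fun ⟨h, h'⟩ => ⟨h, fun a b => (h' a.1 a.2 b.1 b.2).2.2⟩⟩

theorem IsInducedSteiner.mono {W X X' : Set V} (h : IsInducedSteiner G W X) (hX : X ⊆ X') :
    IsInducedSteiner G W X' := by
  rw [isInducedSteiner_iff] at h ⊢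
  exact ⟨h.1.trans hX, fun a ha b hb => (h.2 a ha b hb).mono hX⟩

theorem Joinable.isInducedSteiner {W X : Set V} (h : Joinable G X) (hW : W ⊆ X) :
    IsInducedSteiner G W X :=
  isInducedSteiner_iff.2 ⟨hW, fun a ha b hb => h a (hW ha) b (hW hb)⟩

theorem Joinable.of_center {X : Set V} (a : V) (h : ∀ b ∈ X, Joined G X a b) : Joinable G X :=
  fun _ hx _ hy => (h _ hx).symm.trans (h _ hy)

/-- What is joined to `a` in `G[X]` is joined to `a` inside the component of `a`. -/
theorem Joined.joined_component {X : Set V} {a b : V} (h : Joined G X a b) :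
    Joined G {x | Joined G X a x} a b := by
  refine h.mem_of_closed (S := {y | Joined G {x | Joined G X a x} a y}) (.refl (.refl h.1)) ?_
  intro x hx _ y hy hxy
  have hx' : Joined G {x | Joined G X a x} a x := hx
  have hax : Joined G X a x := hx'.2.1
  exact hx'.step (hax.step hy hxy) hxy

theorem joinable_component {X : Set V} {a : V} : Joinable G {x | Joined G X a x} :=
  .of_center a fun _ hb => hb.joined_component

theorem Joinable.connected {X : Set V} (h : Joinable G X) (hX : X.Nonempty) :
    (G.induce X).Connected := by
  have : Nonempty X := hX.to_subtype
  exact ⟨fun a b => (h a.1 a.2 b.1 b.2).2.2⟩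

/-- Minimal induced Steiner subgraphs are connected. -/
theorem IsMinimalInducedSteiner.joinable {W X : Set V} (h : IsMinimalInducedSteiner G W X) :
    Joinable G X := by
  rcases W.eq_empty_or_nonempty with rfl | ⟨a, ha⟩
  · have : IsInducedSteiner G ∅ ∅ := isInducedSteiner_iff.2 ⟨subset_rfl, by simp⟩
    intro x hx
    exact absurd (h.2 this (Set.empty_subset _) hx) (Set.notMem_empty x)
  · have h1 := isInducedSteiner_iff.1 h.1
    have h2 : X ⊆ {x | Joined G X a x} :=
      h.2 (joinable_component.isInducedSteiner fun b hb => h1.2 a ha b hb) fun _ hb => hb.2.1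
    exact .of_center a fun b hb => h2 hb

theorem IsMinimalInducedSteiner.subset {W X : Set V} (h : IsMinimalInducedSteiner G W X) :
    W ⊆ X := (isInducedSteiner_iff.1 h.1).1

/-- In a claw-free graph, two of any three neighbours of a vertex are adjacent. -/
theorem ClawFree.adj_of_nonadj (hG : ClawFree G) {c x y z : V} (hx : G.Adj c x) (hy : G.Adj c y)
    (hz : G.Adj c z) (hzx : z ≠ x) (hzy : z ≠ y) (hxy : x ≠ y) (nzx : ¬ G.Adj z x)
    (nzy : ¬ G.Adj z y) : G.Adj x y := by
  by_contra nxy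
  refine hG ⟨⟨⟨Sum.elim (fun _ => c) ![x, y, z], ?_⟩, ?_⟩⟩
  · have := hx.ne; have := hy.ne; have := hz.ne
    rintro (a | a) (b | b) h
    · simp [Subsingleton.elim a b]
    · fin_cases b <;> simp_all
    · fin_cases a <;> simp_all [eq_comm]
    · fin_cases a <;> fin_cases b <;> simp_all [eq_comm]
  · have nxz : ¬ G.Adj x z := fun h => nzx h.symm
    have nyz : ¬ G.Adj y z := fun h => nzy h.symm
    have nyx : ¬ G.Adj y x := fun h => nxy h.symm
    intro a b
    change G.Adj (Sum.elim (fun _ => c) ![x, y, z] a) (Sum.elim (fun _ => c) ![x, y, z] b) ↔ _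
    rcases a with a | a <;> rcases b with b | b
    · simp
    · fin_cases b <;> simp_all
    · fin_cases a <;> simp [hx.symm, hy.symm, hz.symm]
    · fin_cases a <;> fin_cases b <;> simp_all

/-! ### Splitting at a non-terminal -/

/-- `C` and `D` are the vertex sets of the components of `G[X \ {v}]`, and there are exactly two
of them. -/
structure Split (G : SimpleGraph V) (X : Set V) (v : V) (C D : Set V) : Prop where
  union : C ∪ D = X \ {v}
  disjoint : Disjoint C D
  nonadj : ∀ x ∈ C, ∀ y ∈ D, ¬ G.Adj x y
  joinable_left : Joinable G C
  joinable_right : Joinable G D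
  nonempty_left : C.Nonempty
  nonempty_right : D.Nonempty

theorem Split.symm {X C D : Set V} {v : V} (h : Split G X v C D) : Split G X v D C where
  union := by rw [Set.union_comm, h.union]
  disjoint := h.disjoint.symm
  nonadj x hx y hy hxy := h.nonadj y hy x hx hxy.symm
  joinable_left := h.joinable_right
  joinable_right := h.joinable_left
  nonempty_left := h.nonempty_right
  nonempty_right := h.nonempty_left

theorem Split.eq_component {X C D : Set V} {v a : V} (h : Split G X v C D) (ha : a ∈ C) :
    {x | Joined G (X \ {v}) a x} = C := by
  have hC : C ⊆ X \ {v} := h.union ▸ Set.subset_union_left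
  refine Set.Subset.antisymm (fun x hx => ?_) fun x hx => (h.joinable_left a ha x hx).mono hC
  refine Joined.mem_of_closed hx ha fun x hx _ y hy hxy => ?_
  rw [← h.union] at hy
  exact hy.resolve_right fun hy => h.nonadj x hx y hy hxy

theorem Split.isComponentOf {X C D : Set V} {v : V} (h : Split G X v C D) :
    IsComponentOf G (X \ {v}) C := by
  obtain ⟨a, ha⟩ := h.nonempty_left
  have hC : C ⊆ X \ {v} := h.union ▸ Set.subset_union_left
  refine ⟨(G.induce (X \ {v})).connectedComponentMk ⟨a, hC ha⟩, ?_⟩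
  ext x
  rw [← h.eq_component ha]
  constructor
  · rintro ⟨_, hx, hr⟩
    exact ⟨⟨x, hx⟩, SimpleGraph.ConnectedComponent.sound hr.symm, rfl⟩
  · rintro ⟨x, hx, rfl⟩
    exact ⟨hC ha, x.2, (SimpleGraph.ConnectedComponent.exact hx).symm⟩

/-- Each side of a split contains a terminal: otherwise the other side alone would be a smaller
induced Steiner subgraph. -/
theorem Split.terminal_left {W X C D : Set V} {v : V} (hX : IsMinimalInducedSteiner G W X)
    (hv : v ∈ X \ W) (h : Split G X v C D) : (W ∩ C).Nonempty := by
  by_contra hne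
  have hWD : W ⊆ D := fun x hx => by
    have : x ∈ X \ {v} := ⟨hX.subset hx, fun hxv => hv.2 (hxv ▸ hx)⟩
    rw [← h.union] at this
    exact this.resolve_left fun hC => hne ⟨x, hx, hC⟩
  have hDX : D ⊆ X \ {v} := h.union ▸ Set.subset_union_right
  exact (hDX (hX.2 (h.joinable_right.isInducedSteiner hWD) (hDX.trans Set.sdiff_subset) hv.1)).2 rfl

/-- A non-terminal `v` of a minimal induced Steiner subgraph of a claw-free graph splits it into
exactly two components: with a third one, `v` would be the centre of a claw. -/
theorem ClawFree.split (hG : ClawFree G) {W X : Set V} {v a : V}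
    (hX : IsMinimalInducedSteiner G W X) (hv : v ∈ X \ W) (ha : a ∈ X \ {v}) :
    Split G X v {x | Joined G (X \ {v}) a x} ((X \ {v}) \ {x | Joined G (X \ {v}) a x}) := by
  have hWX : W ⊆ X \ {v} := fun x hx => ⟨hX.subset hx, fun h => hv.2 (h ▸ hx)⟩
  -- every component of `G[X \ {v}]` contains a neighbour of `v`
  have hnb : ∀ b ∈ X \ {v}, ∃ c, Joined G (X \ {v}) b c ∧ G.Adj v c := by
    intro b hb
    by_contra hne
    push Not at hne
    refine (Joined.mem_of_closed (S := {x | Joined G (X \ {v}) b x}) (hX.joinable b hb.1 v hv.1)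
      (.refl hb) fun x hx _ y hy hxy => ?_).2.1.2 rfl
    have : y ≠ v := fun h => hne x hx (h ▸ hxy.symm)
    exact Joined.step hx ⟨hy, this⟩ hxy
  have hsub : {x | Joined G (X \ {v}) a x} ⊆ X \ {v} := fun x hx => hx.2.1
  refine ⟨Set.union_sdiff_cancel hsub, Set.disjoint_sdiff_right,
    fun x hx y hy hxy => hy.2 (Joined.step hx hy.1 hxy), joinable_component, ?_,
    ⟨a, Joined.refl ha⟩, ?_⟩
  · have hC : ∀ b ∈ (X \ {v}) \ {x | Joined G (X \ {v}) a x}, ∀ x, Joined G (X \ {v}) b x →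
        Joined G ((X \ {v}) \ {x | Joined G (X \ {v}) a x}) b x := by
      intro b hb x hx
      refine Joined.mono (fun y hy => ?_) hx.joined_component
      have hy : Joined G (X \ {v}) b y := hy
      refine ⟨hy.2.1, fun hy' => hb.2 ?_⟩
      exact Joined.trans hy' hy.symm
    intro b hb c hc
    refine hC b hb c ?_
    obtain ⟨a', ha', ha''⟩ := hnb a ha
    obtain ⟨b', hb', hb''⟩ := hnb b hb.1
    obtain ⟨c', hc', hc''⟩ := hnb c hc.1
    by_contra hbc
    have nab : ¬ Joined G (X \ {v}) a' b' := fun h => hb.2 ((ha'.trans h).trans hb'.symm)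
    have nac : ¬ Joined G (X \ {v}) a' c' := fun h => hc.2 ((ha'.trans h).trans hc'.symm)
    have nbc : ¬ Joined G (X \ {v}) b' c' := fun h => hbc ((hb'.trans h).trans hc'.symm)
    refine nbc (.of_adj hb'.2.1 hc'.2.1 (hG.adj_of_nonadj hb'' hc'' ha'' ?_ ?_ ?_ ?_ ?_))
    · rintro rfl; exact nab (.refl ha'.2.1)
    · rintro rfl; exact nac (.refl ha'.2.1)
    · rintro rfl; exact nbc (.refl hb'.2.1)
    · exact fun h => nab (.of_adj ha'.2.1 hb'.2.1 h)
    · exact fun h => nac (.of_adj ha'.2.1 hc'.2.1 h)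
  · by_contra hne
    rw [Set.not_nonempty_iff_eq_empty, Set.sdiff_eq_empty] at hne
    have hj : Joinable G (X \ {v}) := .of_center a fun b hb => hne hb
    exact (hX.2 (hj.isInducedSteiner hWX) Set.sdiff_subset hv.1).2 rfl

end Graph

/-! ### Gluing two sides along an induced path -/

section Gluing

variable {V : Type*} {G : SimpleGraph V}

/-- `p 0, …, p k` is an induced path that starts at `w`, whose other vertices are neither in `A` nor
adjacent to `A \ {w}`, that avoids `B`, and whose last vertex is its only one adjacent to `B`. -/
structure Chain (G : SimpleGraph V) (A B : Set V) (w : V) (p : ℕ → V) (k : ℕ) : Prop where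
  zero : p 0 = w
  adj : ∀ i < k, G.Adj (p i) (p (i + 1))
  induced : ∀ i j, i + 1 < j → j ≤ k → ¬ G.Adj (p i) (p j)
  inj : ∀ i j, i < j → j ≤ k → p i ≠ p j
  notMem_left : ∀ i, 1 ≤ i → i ≤ k → p i ∉ A
  nonadj_left : ∀ i, 1 ≤ i → i ≤ k → ∀ a ∈ A, a ≠ w → ¬ G.Adj a (p i)
  notMem_right : ∀ i ≤ k, p i ∉ B
  nonadj_right : ∀ i < k, ∀ b ∈ B, ¬ G.Adj (p i) b
  adj_right : ∃ b ∈ B, G.Adj (p k) b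

/-- `A` is a minimal connection of `w` and the terminals `T₁`, `B` is a minimal connection of the
terminals `T₂`, and at most `w` is adjacent to `B`. -/
structure Sides (G : SimpleGraph V) (T₁ T₂ A B : Set V) (w : V) : Prop where
  minimal_left : IsMinimalInducedSteiner G (T₁ ∪ {w}) A
  minimal_right : IsMinimalInducedSteiner G T₂ B
  nonempty_left : T₁.Nonempty
  nonempty_right : T₂.Nonempty
  notMem_terminal : w ∉ T₁
  disjoint : Disjoint A B
  nonadj : ∀ a ∈ A, a ≠ w → ∀ b ∈ B, ¬ G.Adj a b

/-- The two sides together with a chain that links them. -/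
structure Linked (G : SimpleGraph V) (T₁ T₂ A B : Set V) (w : V) (p : ℕ → V) (k : ℕ) : Prop
    extends Sides G T₁ T₂ A B w, Chain G A B w p k

namespace Linked

variable {T₁ T₂ A B : Set V} {w : V} {p : ℕ → V} {k : ℕ}

theorem mem_left (h : Linked G T₁ T₂ A B w p k) : w ∈ A :=
  h.minimal_left.subset (.inr rfl)

theorem eq_of_eq (h : Linked G T₁ T₂ A B w p k) {i j : ℕ} (hi : i ≤ k) (hj : j ≤ k)
    (hij : p i = p j) : i = j := by
  rcases lt_trichotomy i j with hlt | heq | hlt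
  · exact absurd hij (h.inj i j hlt hj)
  · exact heq
  · exact absurd hij.symm (h.inj j i hlt hi)

/-- The last vertex of the chain has a neighbour that is neither in `B` nor adjacent to `B`: its
predecessor on the chain or, if the chain consists of `w` alone, a vertex of `A`. -/
theorem exists_pred (h : Linked G T₁ T₂ A B w p k) :
    ∃ z, G.Adj (p k) z ∧ z ∉ B ∧ ∀ b ∈ B, ¬ G.Adj z b := by
  rcases Nat.eq_zero_or_pos k with rfl | hk
  · rw [h.zero]
    by_contra! hne
    obtain ⟨t, ht⟩ := h.nonempty_left
    have hj := h.minimal_left.joinable w h.mem_left t (h.minimal_left.subset (.inl ht))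
    have : t ∈ ({w} : Set V) := by
      refine hj.mem_of_closed rfl ?_
      rintro x rfl - y hy hxy
      by_contra hyw
      obtain ⟨b, hb, hyb⟩ := hne y hxy (Set.disjoint_left.1 h.disjoint hy)
      exact h.nonadj y hy hyw b hb hyb
    exact h.notMem_terminal (this ▸ ht)
  · obtain ⟨i, rfl⟩ : ∃ i, k = i + 1 := ⟨k - 1, by omega⟩
    exact ⟨p i, (h.adj i (by omega)).symm, h.notMem_right i (by omega),
      h.nonadj_right i (by omega)⟩

/-- Only the last vertex of the chain is adjacent to `B`. -/
theorem eq_last_of_adj (h : Linked G T₁ T₂ A B w p k) {x b : V} (hx : x ∈ A ∪ p '' Set.Iic k)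
    (hb : b ∈ B) (hxb : G.Adj x b) : x = p k := by
  have key : ∀ i ≤ k, G.Adj (p i) b → p i = p k := fun i hi hib => by
    rcases hi.lt_or_eq with hi | rfl
    · exact absurd hib (h.nonadj_right i hi b hb)
    · rfl
  rcases hx with hx | ⟨i, hi, rfl⟩
  · by_cases hxw : x = w
    · rw [hxw, ← h.zero] at hxb ⊢
      exact key 0 (Nat.zero_le k) hxb
    · exact absurd hxb (h.nonadj x hx hxw b hb)
  · exact key i hi hxb

/-- By claw-freeness the neighbours of the last chain vertex in `B` form a clique, so a connection
of the terminals in `B` gains nothing from leaving `B`. -/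
theorem right_subset (hG : ClawFree G) (h : Linked G T₁ T₂ A B w p k) {S : Set V}
    (hS : S ⊆ A ∪ B ∪ p '' Set.Iic k) (hST : IsInducedSteiner G T₂ S) : B ⊆ S := by
  rw [isInducedSteiner_iff] at hST
  have hpk : ∀ x ∈ S, x ∉ B → x ∈ A ∪ p '' Set.Iic k := fun x hx hxB => by
    rcases hS hx with (hx | hx) | hx
    exacts [.inl hx, absurd hx hxB, .inr hx]
  obtain ⟨z, hz, hzB, hzb⟩ := h.exists_pred
  have hSB : IsInducedSteiner G T₂ (S ∩ B) := by
    rw [isInducedSteiner_iff]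
    refine ⟨fun t ht => ⟨hST.1 ht, h.minimal_right.subset ht⟩, fun t ht t' ht' => ?_⟩
    -- everything outside `B` that `t` can reach is reached through a neighbour `y` of `p k`
    have key := (hST.2 t ht t' ht').mem_of_closed
      (S := {x | Joined G (S ∩ B) t x ∨ x ∉ B ∧ ∃ y, Joined G (S ∩ B) t y ∧ G.Adj (p k) y})
      (.inl (.refl ⟨hST.1 ht, h.minimal_right.subset ht⟩)) ?_
    · exact key.resolve_right fun h' => h'.1 (h.minimal_right.subset ht')
    · rintro x (hx | ⟨hxB, y, hy, hyk⟩) hxS x' hx'S hxx'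
      · by_cases hx'B : x' ∈ B
        · exact .inl (hx.step ⟨hx'S, hx'B⟩ hxx')
        · have := h.eq_last_of_adj (hpk x' hx'S hx'B) hx.2.1.2 hxx'.symm
          exact .inr ⟨hx'B, x, hx, this ▸ hxx'.symm⟩
      · by_cases hx'B : x' ∈ B
        · have hxk := h.eq_last_of_adj (hpk x hxS hxB) hx'B hxx'
          subst hxk
          left
          by_cases hyx : y = x'
          · exact hyx ▸ hy
          · refine hy.step ⟨hx'S, hx'B⟩ (hG.adj_of_nonadj hyk hxx' hz ?_ ?_ hyx
              (hzb y hy.2.1.2) (hzb x' hx'B))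
            · rintro rfl; exact hzB hy.2.1.2
            · rintro rfl; exact hzB hx'B
        · exact .inr ⟨hx'B, y, hy, hyk⟩
  exact (h.minimal_right.2 hSB Set.inter_subset_right).trans Set.inter_subset_left

theorem joined_chain (h : Linked G T₁ T₂ A B w p k) {S : Set V} {i : ℕ} :
    ∀ {j}, i ≤ j → j ≤ k → (∀ l, i ≤ l → l ≤ j → p l ∈ S) → Joined G S (p i) (p j) := by
  intro j hij
  induction j, hij using Nat.le_induction with
  | base => exact fun _ hS => .refl (hS i le_rfl le_rfl)
  | succ j hij ih =>
    exact fun hj hS => (ih (by omega) fun l hl hl' => hS l hl (by omega)).step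
      (hS _ (by omega) le_rfl) (h.adj j (by omega))

/-- The side of `w` after cutting the chain just before `p i`. -/
theorem joinable_before (h : Linked G T₁ T₂ A B w p k) {i : ℕ} (hi : i ≤ k + 1) :
    Joinable G (A ∪ p '' Set.Iio i) := by
  refine .of_center w ?_
  rintro x (hx | ⟨j, hj, rfl⟩)
  · exact (h.minimal_left.joinable w h.mem_left x hx).mono Set.subset_union_left
  · have hj' : j < i := hj
    rw [← h.zero]
    exact h.joined_chain (Nat.zero_le j) (by omega)
      fun l _ hl => .inr ⟨l, by simp only [Set.mem_Iio]; omega, rfl⟩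

/-- The side of `B` after cutting the chain just before `p i`. -/
theorem joinable_after (h : Linked G T₁ T₂ A B w p k) {i : ℕ} :
    Joinable G (p '' Set.Icc i k ∪ B) := by
  obtain ⟨b, hb, hkb⟩ := h.adj_right
  refine .of_center b ?_
  rintro x (⟨j, hj, rfl⟩ | hx)
  · refine .trans (.of_adj (.inr hb) (.inl ⟨k, ⟨hj.1.trans hj.2, le_rfl⟩, rfl⟩) hkb.symm)
      (Joined.symm (h.joined_chain hj.2 le_rfl fun l hl hl' => ?_))
    exact .inl ⟨l, ⟨hj.1.trans hl, hl'⟩, rfl⟩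
  · exact (h.minimal_right.joinable b hb x hx).mono Set.subset_union_right

theorem joinable (h : Linked G T₁ T₂ A B w p k) : Joinable G (A ∪ B ∪ p '' Set.Iic k) := by
  have hA : A ∪ p '' Set.Iio (k + 1) ⊆ A ∪ B ∪ p '' Set.Iic k := by
    rintro x (hx | ⟨j, hj, rfl⟩)
    exacts [.inl (.inl hx), .inr ⟨j, Nat.lt_succ_iff.1 hj, rfl⟩]
  have hB : p '' Set.Icc 0 k ∪ B ⊆ A ∪ B ∪ p '' Set.Iic k := by
    rintro x (⟨j, hj, rfl⟩ | hx)
    exacts [.inr ⟨j, hj.2, rfl⟩, .inl (.inr hx)]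
  have hw : w ∈ p '' Set.Icc 0 k := ⟨0, by simp, h.zero⟩
  refine .of_center w ?_
  rintro x ((hx | hx) | hx)
  · exact (h.joinable_before le_rfl w (.inl h.mem_left) x (.inl hx)).mono hA
  · exact (h.joinable_after w (.inl hw) x (.inr hx)).mono hB
  · obtain ⟨j, hj, rfl⟩ := hx
    exact (h.joinable_after w (.inl hw) _ (.inl ⟨j, ⟨Nat.zero_le j, hj⟩, rfl⟩)).mono hB

/-- There is no edge between the two parts of the glued set when `p i` is removed. -/
theorem nonadj_parts (h : Linked G T₁ T₂ A B w p k) {i : ℕ} {x y : V} (hi : i ≤ k)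
    (hx : x ∈ A \ {w} ∪ p '' Set.Iio i) (hy : y ∈ p '' Set.Ioc i k ∪ B) : ¬ G.Adj x y := by
  rcases hx with hx | ⟨j, hj, rfl⟩ <;> rcases hy with ⟨l, hl, rfl⟩ | hy
  · exact h.nonadj_left l (by have := hl.1; omega) hl.2 x hx.1 hx.2
  · exact h.nonadj x hx.1 hx.2 y hy
  · have hj' : j < i := hj
    exact h.induced j l (by have := hl.1; omega) hl.2
  · exact h.nonadj_right j (lt_of_lt_of_le hj hi) y hy

theorem disjoint_parts (h : Linked G T₁ T₂ A B w p k) {i : ℕ} {x : V} (hi : i ≤ k)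
    (hx : x ∈ A \ {w} ∪ p '' Set.Iio i) (hy : x ∈ p '' Set.Ioc i k ∪ B) : False := by
  rcases hx with hx | ⟨j, hj, rfl⟩ <;> rcases hy with ⟨l, hl, hlx⟩ | hy
  · subst hlx
    exact h.notMem_left l (by have := hl.1; omega) hl.2 hx.1
  · exact Set.disjoint_left.1 h.disjoint hx.1 hy
  · have hj' : j < i := hj
    have := h.eq_of_eq hl.2 (by omega) hlx
    have := hl.1
    omega
  · exact h.notMem_right j (le_of_lt (lt_of_lt_of_le hj hi)) hy

theorem mem_parts (h : Linked G T₁ T₂ A B w p k) {i : ℕ} (hi : i ≤ k) {x : V}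
    (hx : x ∈ A ∪ B ∪ p '' Set.Iic k) (hxi : x ≠ p i) :
    x ∈ (A \ {w} ∪ p '' Set.Iio i) ∪ (p '' Set.Ioc i k ∪ B) := by
  have key : ∀ j ≤ k, p j ≠ p i → p j ∈ (A \ {w} ∪ p '' Set.Iio i) ∪ (p '' Set.Ioc i k ∪ B) := by
    intro j hj hji
    rcases lt_trichotomy j i with hlt | rfl | hlt
    · exact .inl (.inr ⟨j, hlt, rfl⟩)
    · exact absurd rfl hji
    · exact .inr (.inl ⟨j, ⟨hlt, hj⟩, rfl⟩)
  rcases hx with (hx | hx) | ⟨j, hj, rfl⟩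
  · by_cases hxw : x = w
    · obtain rfl : x = p 0 := hxw.trans h.zero.symm
      exact key 0 (Nat.zero_le k) hxi
    · exact .inl (.inl ⟨hx, hxw⟩)
  · exact .inr (.inr hx)
  · exact key j hj hxi

/-- The glued set is already minimal. -/
theorem minimal (hG : ClawFree G) (h : Linked G T₁ T₂ A B w p k) :
    IsMinimalInducedSteiner G (T₁ ∪ T₂) (A ∪ B ∪ p '' Set.Iic k) := by
  refine ⟨h.joinable.isInducedSteiner ?_, fun S hS hSZ => ?_⟩
  · rintro x (hx | hx)
    exacts [.inl (.inl (h.minimal_left.subset (.inl hx))),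
      .inl (.inr (h.minimal_right.subset hx))]
  have hST := isInducedSteiner_iff.1 hS
  have hB : B ⊆ S := h.right_subset hG hSZ (isInducedSteiner_iff.2
    ⟨Set.subset_union_right.trans hST.1, fun a ha b hb => hST.2 a (.inr ha) b (.inr hb)⟩)
  obtain ⟨t₁, ht₁⟩ := h.nonempty_left
  obtain ⟨t₂, ht₂⟩ := h.nonempty_right
  have hne : ∀ t ∈ T₁, t ∈ A \ {w} := fun t ht =>
    ⟨h.minimal_left.subset (.inl ht), fun htw => h.notMem_terminal (htw ▸ ht)⟩
  -- without `p i` the two terminals `t₁` and `t₂` are separated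
  have hP : ∀ i ≤ k, p i ∈ S := by
    intro i hi
    by_contra hiS
    refine h.disjoint_parts hi ?_ (.inr (h.minimal_right.subset ht₂))
    refine (hST.2 t₁ (.inl ht₁) t₂ (.inr ht₂)).mem_of_closed (.inl (hne t₁ ht₁)) ?_
    intro x hx _ y hy hxy
    refine (h.mem_parts hi (hSZ hy) fun hyi => hiS (hyi ▸ hy)).resolve_right fun hy' => ?_
    exact h.nonadj_parts hi hx hy' hxy
  have hw : w ∈ S := h.zero ▸ hP 0 (Nat.zero_le k)
  -- inside `A`, every terminal is joined to `w`, the only exit from `A`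
  have hSA : IsInducedSteiner G (T₁ ∪ {w}) (S ∩ A) := by
    have hTw : ∀ t ∈ T₁ ∪ {w}, Joined G (S ∩ A) t w := by
      rintro t (ht | rfl)
      · by_contra hnw
        have htt := (hST.2 t (.inl ht) t₂ (.inr ht₂)).mem_of_closed
          (S := {x | Joined G (S ∩ A) t x}) (.refl ⟨hST.1 (.inl ht), (hne t ht).1⟩) ?_
        · exact Set.disjoint_left.1 h.disjoint htt.2.1.2 (h.minimal_right.subset ht₂)
        · intro x hx hxS y hy hxy
          have hx' : Joined G (S ∩ A) t x := hx
          have hxw : x ≠ w := by rintro rfl; exact hnw hx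
          refine hx'.step ⟨hy, ?_⟩ hxy
          by_contra hyA
          have hyw : y ≠ p 0 := by rw [h.zero]; rintro rfl; exact hyA h.mem_left
          rcases h.mem_parts (Nat.zero_le k) (hSZ hy) hyw with (hy' | ⟨j, hj, -⟩) | hy'
          · exact hyA hy'.1
          · exact absurd hj (Nat.not_lt_zero j)
          · exact h.nonadj_parts (Nat.zero_le k) (.inl ⟨hx'.2.1.2, hxw⟩) hy' hxy
      · exact .refl ⟨hw, h.mem_left⟩
    exact isInducedSteiner_iff.2 ⟨fun t ht => (hTw t ht).1,
      fun t ht t' ht' => (hTw t ht).trans (hTw t' ht').symm⟩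
  rintro x ((hx | hx) | ⟨i, hi, rfl⟩)
  · exact (h.minimal_left.2 hSA Set.inter_subset_right hx).1
  · exact hB hx
  · exact hP i hi

/-- Removing an inner or last vertex of the chain splits the glued set along the chain. -/
theorem split (h : Linked G T₁ T₂ A B w p k) {i : ℕ} (hi : 1 ≤ i) (hik : i ≤ k) :
    Split G (A ∪ B ∪ p '' Set.Iic k) (p i) (A ∪ p '' Set.Iio i) (p '' Set.Icc (i + 1) k ∪ B) := by
  have hleft : A ∪ p '' Set.Iio i = A \ {w} ∪ p '' Set.Iio i := by
    ext x
    refine ⟨?_, fun hx => hx.imp (fun h => h.1) id⟩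
    rintro (hx | hx)
    · by_cases hxw : x = w
      · exact .inr ⟨0, hi, h.zero.trans hxw.symm⟩
      · exact .inl ⟨hx, hxw⟩
    · exact .inr hx
  have hright : p '' Set.Icc (i + 1) k ∪ B = p '' Set.Ioc i k ∪ B := by
    congr 2
  refine ⟨?_, ?_, ?_, h.joinable_before (by omega), h.joinable_after, ⟨w, .inl h.mem_left⟩, ?_⟩
  · ext x
    constructor
    · rintro ((hx | ⟨j, hj, rfl⟩) | (⟨j, hj, rfl⟩ | hx))
      · exact ⟨.inl (.inl hx), fun hxi => h.notMem_left i hi hik (hxi ▸ hx)⟩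
      · have hj' : j < i := hj
        exact ⟨.inr ⟨j, by simp only [Set.mem_Iic]; omega, rfl⟩, h.inj j i hj' hik⟩
      · exact ⟨.inr ⟨j, hj.2, rfl⟩, (h.inj i j hj.1 hj.2).symm⟩
      · exact ⟨.inl (.inr hx), fun hxi => h.notMem_right i hik (hxi ▸ hx)⟩
    · rw [hleft, hright]
      exact fun hx => h.mem_parts hik hx.1 hx.2
  · rw [hleft, hright]
    exact Set.disjoint_left.2 fun x hx hy => h.disjoint_parts hik hx hy
  · rw [hleft, hright]
    exact fun x hx y hy => h.nonadj_parts hik hx hy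
  · obtain ⟨b, hb, -⟩ := h.adj_right
    exact ⟨b, .inr hb⟩

/-- The remainder of the chain is useless for connecting the terminals of `B`. -/
theorem right_unique (hG : ClawFree G) (h : Linked G T₁ T₂ A B w p k) {B' : Set V}
    (hB' : IsMinimalInducedSteiner G T₂ B') (hs : B' ⊆ A ∪ B ∪ p '' Set.Iic k) : B' = B :=
  have hB := h.right_subset hG hs hB'.1
  (hB'.2 h.minimal_right.1 hB).antisymm hB

end Linked

end Gluing

/-! ### Shortest paths are chains -/

section Paths

variable {V : Type*} {G : SimpleGraph V}

/-- A walk of `G` along a sequence of vertices. -/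
theorem exists_walk_of_seq {q : ℕ → V} {m : ℕ} (hq : ∀ i < m, G.Adj (q i) (q (i + 1))) :
    ∃ p : G.Walk (q 0) (q m), ∀ x ∈ p.support, ∃ i ≤ m, q i = x := by
  induction m with
  | zero => exact ⟨.nil, fun x hx => ⟨0, le_rfl, by simpa [eq_comm] using hx⟩⟩
  | succ m ih =>
    obtain ⟨p, hp⟩ := ih fun i hi => hq i (by omega)
    refine ⟨p.concat (hq m (by omega)), fun x hx => ?_⟩
    rw [SimpleGraph.Walk.support_concat, List.mem_append,
      List.mem_singleton] at hx
    rcases hx with hx | rfl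
    · obtain ⟨i, hi, rfl⟩ := hp x hx
      exact ⟨i, by omega, rfl⟩
    · exact ⟨m + 1, le_rfl, rfl⟩

/-- A sequence of adjacent vertices that starts in `D` and ends outside has a last exit from `D`. -/
theorem exists_last_exit {D : Set V} {r : ℕ → V} {m : ℕ} (hr : ∀ i < m, G.Adj (r i) (r (i + 1)))
    (h0 : r 0 ∈ D) (hm : r m ∉ D) :
    ∃ j, 1 ≤ j ∧ j ≤ m ∧ r j ∈ nbhd G D ∧
      ∀ i, j < i → i ≤ m → r i ∉ D ∧ r i ∉ nbhd G D := by
  classical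
  set j := Nat.findGreatest (fun j => r j ∈ D ∪ nbhd G D) m with hj
  have hspec : r j ∈ D ∪ nbhd G D :=
    Nat.findGreatest_spec (P := fun j => r j ∈ D ∪ nbhd G D) (Nat.zero_le m) (.inl h0)
  have hjm : j ≤ m := Nat.findGreatest_le m
  have hgt : ∀ i, j < i → i ≤ m → r i ∉ D ∪ nbhd G D := fun i hi him =>
    Nat.findGreatest_is_greatest hi him
  have hjD : r j ∉ D := by
    intro hjD
    have hlt : j < m := hjm.lt_of_ne fun h => hm (h ▸ hjD)
    refine hgt (j + 1) (by omega) hlt ?_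
    by_cases h : r (j + 1) ∈ D
    · exact .inl h
    · exact .inr ⟨h, r j, hjD, hr j hlt⟩
  refine ⟨j, Nat.one_le_iff_ne_zero.2 fun h => hjD (h ▸ h0), hjm, hspec.resolve_left hjD,
    fun i hi him => ?_⟩
  have := hgt i hi him
  exact ⟨fun h => this (.inl h), fun h => this (.inr h)⟩

/-- A path that cannot be shortened within its own vertex set is induced. -/
theorem nonadj_of_shortest {w u : V} {p : G.Walk w u}
    (hmin : ∀ q : G.Walk w u, (∀ x ∈ q.support, x ∈ p.support) → p.length ≤ q.length)
    {i j : ℕ} (hij : i + 1 < j) (hj : j ≤ p.length) : ¬ G.Adj (p.getVert i) (p.getVert j) := by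
  intro hadj
  have := hmin ((p.take i).append (.cons hadj (p.drop j))) fun x hx => by
    rw [SimpleGraph.Walk.mem_support_append_iff, SimpleGraph.Walk.support_cons,
      List.mem_cons] at hx
    rcases hx with hx | rfl | hx
    · rw [SimpleGraph.Walk.support_take] at hx
      exact List.mem_of_mem_take hx
    · exact p.getVert_mem_support i
    · rw [SimpleGraph.Walk.drop_support_eq_support_drop_min] at hx
      exact List.mem_of_mem_drop hx
  rw [SimpleGraph.Walk.length_append, SimpleGraph.Walk.length_cons, SimpleGraph.Walk.take_length,
    SimpleGraph.Walk.drop_length] at this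
  omega

theorem chain_of_path {A B : Set V} {w u : V} {p : G.Walk w u} (hp : p.IsPath)
    (hmin : ∀ q : G.Walk w u, (∀ x ∈ q.support, x ∈ p.support) → p.length ≤ q.length)
    (hA : ∀ x ∈ p.support, x ≠ w → x ∉ A ∧ x ∉ nbhd G (A \ {w})) (hu : u ∈ nbhd G B)
    (hB : ∀ i < p.length, p.getVert i ∉ B ∧ p.getVert i ∉ nbhd G B) :
    Chain G A B w p.getVert p.length := by
  have hinj : ∀ i j, i < j → j ≤ p.length → p.getVert i ≠ p.getVert j := fun i j hij hj h => by
    have := hp.getVert_injOn (Set.mem_ofPred.2 (by omega)) (Set.mem_ofPred.2 hj) h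
    omega
  have hw : ∀ i, 1 ≤ i → i ≤ p.length → p.getVert i ≠ w := fun i hi hik h =>
    hinj 0 i hi hik (by rw [p.getVert_zero, h])
  refine ⟨p.getVert_zero, fun i hi => p.adj_getVert_succ hi,
    fun i j hij hj => nonadj_of_shortest hmin hij hj, hinj, fun i hi hik => ?_, fun i hi hik => ?_,
    fun i hi => ?_, fun i hi b hb hib => ?_, ?_⟩
  · exact (hA _ (p.getVert_mem_support i) (hw i hi hik)).1
  · intro a ha haw hadj
    have := hA _ (p.getVert_mem_support i) (hw i hi hik)
    exact this.2 ⟨fun h => this.1 h.1, a, ⟨ha, haw⟩, hadj⟩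
  · rcases hi.lt_or_eq with hi | rfl
    · exact (hB i hi).1
    · rw [p.getVert_length]
      exact hu.1
  · exact (hB i hi).2 ⟨(hB i hi).1, b, hb, hib.symm⟩
  · obtain ⟨-, b, hb, hbu⟩ := hu
    exact ⟨b, hb, by rw [p.getVert_length]; exact hbu.symm⟩

theorem image_getVert_Iic {w u : V} (p : G.Walk w u) :
    p.getVert '' Set.Iic p.length = {x | x ∈ p.support} := by
  ext x
  simp only [Set.mem_image, Set.mem_Iic, Set.mem_ofPred_eq,
    SimpleGraph.Walk.mem_support_iff_exists_getVert]
  exact ⟨fun ⟨i, hi, h⟩ => ⟨i, h, hi⟩, fun ⟨i, h, hi⟩ => ⟨i, hi, h⟩⟩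

end Paths

/-! ### Progress in the solution graph -/

section Progress

variable {V : Type*} {G : SimpleGraph V} {W : Set V} {μ : Set V → Set V → Set V}

/-- A walk `q 0, …, q m` that starts next to `C`, does not come into or next to `C` again, and ends
next to `B`. -/
structure Escape (G : SimpleGraph V) (C B : Set V) (q : ℕ → V) (m : ℕ) : Prop where
  start : q 0 ∈ nbhd G C
  adj : ∀ i < m, G.Adj (q i) (q (i + 1))
  away : ∀ i, 1 ≤ i → i ≤ m → q i ∉ C ∧ q i ∉ nbhd G C
  arrive : q m ∈ nbhd G B

/-- A relation on the solutions *reroutes* if, whenever a vertex `v` of a solution splits it and an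
escape from the one side to the other avoids `v`, the solution is related to one that is glued
along some chain. -/
def Reroutes (G : SimpleGraph V) (W : Set V) (μ : Set V → Set V → Set V)
    (rel : Solution G W → Solution G W → Prop) : Prop :=
  ∀ (X : Solution G W) (v : V) (C D : Set V), v ∈ X.1 \ W → Split G X.1 v C D →
    ∀ (q : ℕ → V) (m : ℕ), Escape G C (side₂ W μ D) q m → (∀ i ≤ m, q i ≠ v) →
      Sides G (W ∩ C) (W ∩ D) (side₁ W μ C (q 0)) (side₂ W μ D) (q 0) →
      ∃ (p : ℕ → V) (k : ℕ), Chain G (side₁ W μ C (q 0)) (side₂ W μ D) (q 0) p k ∧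
        ∀ Z : Solution G W, Z.1 = side₁ W μ C (q 0) ∪ side₂ W μ D ∪ p '' Set.Iic k → rel X Z

theorem side₁_spec (hμ : IsMinimizer G μ) {C : Set V} {w : V} (hC : Joinable G C)
    (hw : w ∈ nbhd G C) : side₁ W μ C w ⊆ C ∪ {w} ∧
      IsMinimalInducedSteiner G ((W ∩ C) ∪ {w}) (side₁ W μ C w) := by
  obtain ⟨-, c, hc, hcw⟩ := hw
  refine hμ _ _ (Set.union_subset_union_left _ Set.inter_subset_right)
    (Joinable.connected (.of_center c ?_) ⟨c, .inl hc⟩)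
  rintro x (hx | rfl)
  · exact (hC c hc x hx).mono Set.subset_union_left
  · exact .of_adj (.inl hc) (.inr rfl) hcw

theorem side₂_spec (hμ : IsMinimizer G μ) {D : Set V} (hD : Joinable G D) (hne : D.Nonempty) :
    side₂ W μ D ⊆ D ∧ IsMinimalInducedSteiner G (W ∩ D) (side₂ W μ D) :=
  hμ _ _ Set.inter_subset_right (hD.connected hne)

theorem Split.subset {X C D : Set V} {v : V} (hX : IsMinimalInducedSteiner G W X)
    (hv : v ∈ X \ W) (h : Split G X v C D) : W ⊆ C ∪ D := by
  rw [h.union]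
  exact fun x hx => ⟨hX.subset hx, fun hxv => hv.2 (hxv ▸ hx)⟩

theorem Split.sides (hμ : IsMinimizer G μ) {X C D : Set V} {v w : V}
    (hX : IsMinimalInducedSteiner G W X) (hv : v ∈ X \ W) (h : Split G X v C D)
    (hw : w ∈ nbhd G C) : Sides G (W ∩ C) (W ∩ D) (side₁ W μ C w) (side₂ W μ D) w := by
  have hA := side₁_spec (W := W) hμ h.joinable_left hw
  have hB := side₂_spec (W := W) hμ h.joinable_right h.nonempty_right
  refine ⟨hA.2, hB.2, h.terminal_left hX hv, h.symm.terminal_left hX hv, fun hw' => hw.1 hw'.2,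
    Set.disjoint_left.2 fun x hxA hxB => ?_, fun a ha haw b hb => ?_⟩
  · rcases hA.1 hxA with hx | rfl
    · exact Set.disjoint_left.1 h.disjoint hx (hB.1 hxB)
    · obtain ⟨-, c, hc, hcw⟩ := hw
      exact h.nonadj c hc _ (hB.1 hxB) hcw
  · exact h.nonadj a ((hA.1 ha).resolve_right haw) b (hB.1 hb)

/-- If there is an escape inside `Y`, then all vertices outside `Y` that rerouting brings in can be
removed again. The proof is by induction on the length of the escape: when a vertex of the chain is
removed, the escape is cut at its last exit from the new left side, while its target, the minimal
connection on the right side, stays the same. -/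
theorem Reroutes.exists_reachable (hG : ClawFree G) (hμ : IsMinimizer G μ)
    {rel : Solution G W → Solution G W → Prop} (hrel : Reroutes G W μ rel) (Y : Set V) (m : ℕ) :
    ∀ (X : Solution G W) (v : V) (C D : Set V) (q : ℕ → V), v ∈ X.1 \ W → v ∉ Y →
      Split G X.1 v C D → Escape G C (side₂ W μ D) q m → (∀ i ≤ m, q i ∈ Y) →
      ∃ Z : Solution G W, Relation.ReflTransGen rel X Z ∧ Z.1 \ Y ⊆ (C ∪ side₂ W μ D) \ Y := by
  classical
  induction m using Nat.strong_induction_on with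
  | _ m ih =>
  intro X v C D q hv hvY hs hq hqY
  have hsides := hs.sides hμ X.2 hv hq.start
  have hA := side₁_spec (W := W) hμ hs.joinable_left hq.start
  have hB := side₂_spec (W := W) hμ hs.joinable_right hs.nonempty_right
  obtain ⟨p, k, hchain, hZ⟩ := hrel X v C D hv hs q m hq
    (fun i hi h => hvY (h ▸ hqY i hi)) hsides
  have hl : Linked G (W ∩ C) (W ∩ D) (side₁ W μ C (q 0)) (side₂ W μ D) (q 0) p k :=
    { hsides, hchain with }
  have hW : (W ∩ C) ∪ (W ∩ D) = W := by
    rw [← Set.inter_union_distrib_left, Set.inter_eq_left]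
    exact hs.subset X.2 hv
  have hmin := hl.minimal hG
  rw [hW] at hmin
  have hw : ∀ x ∈ side₁ W μ C (q 0), x ∉ Y → x ∈ C := fun x hx hxY =>
    (hA.1 hx).resolve_right fun hxw => hxY (Set.mem_singleton_iff.1 hxw ▸ hqY 0 (Nat.zero_le m))
  set A := side₁ W μ C (q 0) with hAdef
  set B := side₂ W μ D with hBdef
  have hXZ : rel X ⟨A ∪ B ∪ p '' Set.Iic k, hmin⟩ := hZ _ rfl
  by_cases hP : ∀ i ≤ k, p i ∈ Y
  · refine ⟨_, .single hXZ, ?_⟩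
    rintro x ⟨(hx | hx) | ⟨i, hi, rfl⟩, hxY⟩
    · exact ⟨.inl (hw x hx hxY), hxY⟩
    · exact ⟨.inr hx, hxY⟩
    · exact absurd (hP i hi) hxY
  -- remove the first vertex of the chain that lies outside `Y`
  push Not at hP
  obtain ⟨hik, hiY⟩ := Nat.find_spec hP
  set i := Nat.find hP with hidef
  have hlt : ∀ l < i, p l ∈ Y := fun l hl => by
    by_contra hlY
    exact Nat.find_min hP hl ⟨by omega, hlY⟩
  have hi : 1 ≤ i := Nat.one_le_iff_ne_zero.2 fun h0 => hiY (by
    rw [h0, hl.zero]; exact hqY 0 (Nat.zero_le m))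
  have hsplit := hl.split hi hik
  have hiW : p i ∉ W := by
    rw [← hW]
    rintro (h | h)
    · exact hl.notMem_left i hi hik (hl.minimal_left.subset (.inl h))
    · exact hl.notMem_right i hik (hl.minimal_right.subset h)
  have hWD : W ∩ (p '' Set.Icc (i + 1) k ∪ B) = W ∩ D := by
    ext x
    constructor
    · rintro ⟨hxW, hx⟩
      rcases hs.subset X.2 hv hxW with hxC | hxD
      · exact absurd hx (Set.disjoint_left.1 hsplit.disjoint
          (.inl (hl.minimal_left.subset (.inl ⟨hxW, hxC⟩))))
      · exact ⟨hxW, hxD⟩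
    · exact fun hx => ⟨hx.1, .inr (hl.minimal_right.subset hx)⟩
  have hB' : side₂ W μ (p '' Set.Icc (i + 1) k ∪ B) = B := by
    have h2 := side₂_spec (W := W) hμ hsplit.joinable_right hsplit.nonempty_right
    rw [hWD] at h2
    refine hl.right_unique hG h2.2 (h2.1.trans ?_)
    rintro x (⟨j, hj, rfl⟩ | hx)
    exacts [.inr ⟨j, hj.2, rfl⟩, .inl (.inr hx)]
  obtain ⟨b, hb, hbq⟩ := hq.arrive.2
  obtain ⟨j, hj, hjm, hjn, hj'⟩ := exists_last_exit (D := A ∪ p '' Set.Iio i) hq.adj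
    (.inl hl.mem_left) fun h => hsplit.nonadj _ h b (.inr hb) hbq.symm
  obtain ⟨Z, hZ, hZY⟩ := ih (m - j) (by omega) ⟨_, hmin⟩ (p i) (A ∪ p '' Set.Iio i)
    (p '' Set.Icc (i + 1) k ∪ B) (fun l => q (j + l)) ⟨.inr ⟨i, hik, rfl⟩, hiW⟩ hiY hsplit
    ⟨hjn, fun l hl => hq.adj (j + l) (by omega), fun l hl hl' => hj' (j + l) (by omega) (by omega),
      by rw [hB', Nat.add_sub_cancel' hjm]; exact hq.arrive⟩ fun l hl => hqY _ (by omega)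
  refine ⟨Z, .head hXZ hZ, hZY.trans ?_⟩
  rw [hB']
  rintro x ⟨(hx | ⟨l, hl, rfl⟩) | hx, hxY⟩
  · exact ⟨.inl (hw x hx hxY), hxY⟩
  · exact absurd (hlt l hl) hxY
  · exact ⟨.inr hx, hxY⟩

theorem Reroutes.progress [Finite V] (hG : ClawFree G) (hμ : IsMinimizer G μ)
    {rel : Solution G W → Solution G W → Prop} (hrel : Reroutes G W μ rel) (X Y : Solution G W)
    (hXY : X ≠ Y) : ∃ Z : Solution G W, Relation.ReflTransGen rel X Z ∧
      (Z.1 \ Y.1).ncard < (X.1 \ Y.1).ncard := by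
  classical
  obtain ⟨v, hvX, hvY⟩ : ∃ v ∈ X.1, v ∉ Y.1 := by
    by_contra! h
    exact hXY (Subtype.ext (Set.Subset.antisymm h (Y.2.2 X.2.1 h)))
  have hvW : v ∉ W := fun h => hvY (Y.2.subset h)
  obtain ⟨t, ht⟩ : W.Nonempty := by
    by_contra hW
    rw [Set.not_nonempty_iff_eq_empty] at hW
    have : IsInducedSteiner G W ∅ := isInducedSteiner_iff.2 ⟨hW.le, by simp [hW]⟩
    exact X.2.2 this (Set.empty_subset _) hvX
  have hs := hG.split X.2 ⟨hvX, hvW⟩ (a := t) ⟨X.2.subset ht, fun h => hvW (h ▸ ht)⟩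
  set C := {x | Joined G (X.1 \ {v}) t x}
  set D := (X.1 \ {v}) \ C
  have hB := side₂_spec (W := W) hμ hs.joinable_right hs.nonempty_right
  obtain ⟨t₁, ht₁⟩ := hs.terminal_left X.2 ⟨hvX, hvW⟩
  obtain ⟨t₂, ht₂⟩ := hs.symm.terminal_left X.2 ⟨hvX, hvW⟩
  obtain ⟨p, hp⟩ := ((isInducedSteiner_iff.1 Y.2.1).2 t₁ ht₁.1 t₂ ht₂.1).exists_walk
  -- follow `p` until just before it first meets `side₂ W μ D`
  have hex : ∃ l, p.getVert l ∈ side₂ W μ D :=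
    ⟨p.length, by rw [p.getVert_length]; exact hB.2.subset ht₂⟩
  have hl := Nat.find_spec hex
  have hlen : Nat.find hex ≤ p.length :=
    Nat.find_min' hex (by rw [p.getVert_length]; exact hB.2.subset ht₂)
  have hpos : Nat.find hex ≠ 0 := fun h0 => by
    rw [h0, p.getVert_zero] at hl
    exact Set.disjoint_left.1 hs.disjoint ht₁.2 (hB.1 hl)
  obtain ⟨M, hM⟩ : ∃ M, Nat.find hex = M + 1 := ⟨Nat.find hex - 1, by omega⟩
  rw [hM] at hl hlen
  have hMB : p.getVert M ∈ nbhd G (side₂ W μ D) :=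
    ⟨Nat.find_min hex (by omega), _, hl, (p.adj_getVert_succ hlen).symm⟩
  obtain ⟨j, -, hjM, hjn, hj⟩ := exists_last_exit (D := C) (r := p.getVert) (m := M)
    (fun i hi => p.adj_getVert_succ (by omega)) (by rw [p.getVert_zero]; exact ht₁.2)
    fun h => hs.nonadj _ h _ (hB.1 hl) (p.adj_getVert_succ hlen)
  obtain ⟨Z, hZ, hZY⟩ := hrel.exists_reachable hG hμ Y.1 (M - j) X v C D
    (fun l => p.getVert (j + l)) ⟨hvX, hvW⟩ hvY hs
    ⟨hjn, fun l hl => p.adj_getVert_succ (by omega : j + l < p.length),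
      fun l hl hl' => hj (j + l) (by omega) (by omega),
      by rw [Nat.add_sub_cancel' hjM]; exact hMB⟩ fun l _ => hp _ (p.getVert_mem_support _)
  refine ⟨Z, hZ, Set.ncard_lt_ncard (Set.ssubset_iff_of_subset ?_ |>.2
    ⟨v, ⟨hvX, hvY⟩, fun h => ?_⟩) (Set.toFinite _)⟩
  · have hCD : C ∪ side₂ W μ D ⊆ X.1 :=
      (Set.union_subset_union_right _ hB.1).trans (hs.union.le.trans Set.sdiff_subset)
    exact hZY.trans (Set.sdiff_subset_sdiff_left hCD)
  · have hvCD : v ∈ C ∪ D := Set.union_subset_union_right C hB.1 (hZY h).1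
    rw [hs.union] at hvCD
    exact hvCD.2 rfl

theorem Reroutes.reachable [Finite V] (hG : ClawFree G) (hμ : IsMinimizer G μ)
    {rel : Solution G W → Solution G W → Prop} (hrel : Reroutes G W μ rel) (X Y : Solution G W) :
    Relation.ReflTransGen rel X Y := by
  induction h : (X.1 \ Y.1).ncard using Nat.strong_induction_on generalizing X with
  | _ n ih =>
  by_cases hXY : X = Y
  · exact hXY ▸ .refl
  · obtain ⟨Z, hZ, hlt⟩ := hrel.progress hG hμ X Y hXY
    exact hZ.trans (ih _ (h ▸ hlt) Z rfl)

/-- The arcs of the solution graph reroute: a shortest admissible path is a chain, and since the set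
glued along it is minimal, the last application of `μ` does not change it. -/
theorem arc_reroutes (hμ : IsMinimizer G μ)
    {π : Set V → V → Set V → Set V → V → Set V} (hπ : IsPathSelector G W μ π) :
    Reroutes G W μ (Arc G W μ π) := by
  classical
  intro X v C D hv hs q m hq hqv hsides
  have hA := side₁_spec (W := W) hμ hs.joinable_left hq.start
  have hB := side₂_spec (W := W) hμ hs.joinable_right hs.nonempty_right
  set w := q 0 with hwdef
  set A := side₁ W μ C w with hAdef
  set B := side₂ W μ D with hBdef
  have hAC : A \ {w} ⊆ C := fun x hx => (hA.1 hx.1).resolve_right hx.2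
  -- the escape is an admissible walk, so there is a shortest admissible path
  have hne : (shortestPathSets G A B v w).Nonempty := by
    obtain ⟨p₀, hp₀⟩ := exists_walk_of_seq hq.adj
    have hadm : IsAdmissible G A B v w p₀.bypass := by
      refine ⟨p₀.bypass_isPath, hq.arrive, fun h => ?_, fun x hx hxw => ?_⟩
      · obtain ⟨i, hi, hiv⟩ := hp₀ v (p₀.support_bypass_subset_support h)
        exact hqv i hi hiv
      · obtain ⟨i, hi, rfl⟩ := hp₀ x (p₀.support_bypass_subset_support hx)
        have hi0 : 1 ≤ i := Nat.one_le_iff_ne_zero.2 fun h0 => hxw (h0 ▸ rfl)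
        rintro ⟨-, a, ha, hadj⟩
        exact (hq.away i hi0 hi).2 ⟨(hq.away i hi0 hi).1, a, hAC ha, hadj⟩
    have hex : ∃ l, ∃ (u : V) (p : G.Walk w u), IsAdmissible G A B v w p ∧ p.length = l :=
      ⟨_, _, _, hadm, rfl⟩
    obtain ⟨u, p, hp, hlen⟩ := Nat.find_spec hex
    exact ⟨_, u, p, hp, fun u' p' hp' => hlen ▸ Nat.find_min' hex ⟨u', p', hp', rfl⟩, rfl⟩
  have hπ' := hπ X.1 v C D w hne
  obtain ⟨u, p, ⟨hpath, hu, hpv, hpA⟩, hmin, hset⟩ := hπ'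
  have hnotB : ∀ i < p.length, p.getVert i ∉ nbhd G B := fun i hi h => by
    have hsub : ∀ x ∈ (p.take i).support, x ∈ p.support := fun x hx => by
      rw [SimpleGraph.Walk.support_take] at hx
      exact List.mem_of_mem_take hx
    have := hmin _ (p.take i) ⟨hpath.take i, h, fun h => hpv (hsub _ h),
      fun x hx => hpA x (hsub x hx)⟩
    rw [SimpleGraph.Walk.take_length] at this
    omega
  have hchain : Chain G A B w p.getVert p.length := by
    refine chain_of_path hpath (fun p' hp' => ?_) (fun x hx hxw => ⟨fun hxA => ?_, hpA x hx hxw⟩)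
      hu fun i hi => ⟨?_, hnotB i hi⟩
    · refine (hmin u p'.bypass ⟨p'.bypass_isPath, hu,
        fun h => hpv (hp' _ (p'.support_bypass_subset_support h)),
        fun x hx => hpA x (hp' _ (p'.support_bypass_subset_support hx))⟩).trans
        p'.length_bypass_le_length
    · -- a path that enters `A \ {w}` without touching its neighbourhood never leaves it
      obtain ⟨i, rfl, hi⟩ := SimpleGraph.Walk.mem_support_iff_exists_getVert.1 hx
      have hstay : ∀ j, i ≤ j → j ≤ p.length → p.getVert j ∈ A \ {w} := by
        intro j hij
        induction j, hij using Nat.le_induction with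
        | base => exact fun _ => ⟨hxA, hxw⟩
        | succ j hij ih =>
          intro hj
          have hj' := ih (by omega)
          by_contra hnot
          refine hpA _ (p.getVert_mem_support (j + 1)) (fun hjw => ?_)
            ⟨hnot, _, hj', p.adj_getVert_succ hj⟩
          have := hpath.getVert_injOn (Set.mem_ofPred.2 hj) (Set.mem_ofPred.2 (Nat.zero_le _))
            (hjw.trans p.getVert_zero.symm)
          omega
      have hk := hstay p.length hi le_rfl
      rw [p.getVert_length] at hk
      obtain ⟨-, b, hb, hbu⟩ := hu
      exact hsides.nonadj u hk.1 hk.2 b hb hbu.symm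
    · induction i with
      | zero =>
        rw [p.getVert_zero]
        exact Set.disjoint_left.1 hsides.disjoint (hsides.minimal_left.subset (.inr rfl))
      | succ i ih =>
        exact fun hiB => hnotB i (by omega)
          ⟨ih (by omega), _, hiB, (p.adj_getVert_succ (by omega)).symm⟩
  have hl : Linked G (W ∩ C) (W ∩ D) A B w p.getVert p.length := { hsides, hchain with }
  refine ⟨_, _, hchain, fun Z hZ => ?_⟩
  have hW : W ⊆ Z.1 := Z.2.subset
  have hconn : (G.induce Z.1).Connected := by
    rw [hZ]
    exact hl.joinable.connected ⟨w, .inl (.inl hl.mem_left)⟩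
  have hμZ := hμ Z.1 W hW hconn
  refine ⟨v, w, hv, C, D, hs.isComponentOf, hs.symm.isComponentOf, ?_, ⟨hq.start, ?_⟩, hne, ?_⟩
  · rintro rfl
    exact hs.nonempty_left.ne_empty (disjoint_self.1 hs.disjoint)
  · exact hqv 0 (Nat.zero_le m)
  · rw [hset, ← image_getVert_Iic, ← hZ]
    exact (Z.2.2 hμZ.2.1 hμZ.1).antisymm hμZ.1

end Progress

/-! ### A language of polynomial-time functions -/

/-- An input of the enumeration problem. -/
structure Input : Type where
  n : ℕ
  graph : SimpleGraph (Fin n)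
  terminals : Set (Fin n)

/-- Functions on data, built from a few primitives. The only form of repetition is to iterate a
function as often as the input graph has vertices, so running times are polynomial by
construction. -/
inductive Fn : Type
  | id : Fn
  | nil : Fn
  | graph : Fn
  | terminals : Fn
  | fst : Fn
  | snd : Fn
  | pair (f g : Fn) : Fn
  | comp (g f : Fn) : Fn
  | ite (c f g : Fn) : Fn
  | iter (f : Fn) : Fn

namespace Fn

open Classical in
/-- The function on data that an expression denotes, relative to an input. -/
noncomputable def eval (c : Input) : Fn → Data → Data
  | id, d => d
  | nil, _ => .nil
  | graph, _ => encodeGraph c.graph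
  | terminals, _ => encodeSet c.terminals
  | fst, d => d.fst
  | snd, d => d.snd
  | pair f g, d => .cons (f.eval c d) (g.eval c d)
  | comp g f, d => g.eval c (f.eval c d)
  | ite t f g, d => if t.eval c d ≠ .nil then f.eval c d else g.eval c d
  | iter f, d => (f.eval c)^[c.n] d

/-- A program that replaces the contents of the variable `d` by its image under the function. It
reads the input from the variables `0` and `1`, and writes to no variable below `d`. -/
def compile : Fn → ℕ → Prog
  | id, _ => .skip
  | nil, d => .setNil d
  | graph, d => .copy d 0
  | terminals, d => .copy d 1
  | fst, d => .fst d d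
  | snd, d => .snd d d
  | pair f g, d =>
    .seq (.copy (d + 1) d) <| .seq (f.compile (d + 1)) <| .seq (.copy (d + 2) d) <|
      .seq (g.compile (d + 2)) (.cons d (d + 1) (d + 2))
  | comp g f, d => .seq (f.compile d) (g.compile d)
  | ite t f g, d =>
    .seq (.copy (d + 1) d) <| .seq (t.compile (d + 1)) <| .ite (d + 1) (f.compile d) (g.compile d)
  | iter f, d =>
    -- the adjacency matrix has one row for each vertex, so its list of rows serves as a counter
    .seq (.copy (d + 1) d) <| .seq (.copy d 0) <|
      .seq (.loop d (.seq (.snd d d) (f.compile (d + 1)))) (.copy d (d + 1))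

/-- A bound on the running time, in terms of the number of vertices. -/
noncomputable def time : Fn → Polynomial ℕ
  | pair f g => f.time + g.time + 3
  | comp g f => f.time + g.time
  | ite t f g => t.time + f.time + g.time + 2
  | iter f => .X * (f.time + 2) + 4
  | _ => 1

end Fn

/-- The program runs from `s` to `s'` in time at most `t`, without output. -/
def Runs (p : Prog) (s : Store) (t : ℕ) (s' : Store) : Prop :=
  ∃ tr, Exec p s tr s' ∧ outputs tr = [] ∧ tr.length ≤ t

theorem outputs_append (l l' : List Event) : outputs (l ++ l') = outputs l ++ outputs l' :=
  List.filterMap_append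

theorem outputs_tick (l : List Event) : outputs (.tick :: l) = outputs l := rfl

theorem Runs.seq {p q : Prog} {s s' s'' : Store} {t t' : ℕ} (h : Runs p s t s')
    (h' : Runs q s' t' s'') : Runs (.seq p q) s (t + t') s'' := by
  obtain ⟨tr, he, ho, hl⟩ := h
  obtain ⟨tr', he', ho', hl'⟩ := h'
  exact ⟨_, .seq he he', by rw [outputs_append, ho, ho', List.append_nil],
    by rw [List.length_append]; omega⟩

theorem Runs.mono {p : Prog} {s s' : Store} {t t' : ℕ} (h : Runs p s t s') (ht : t ≤ t') :
    Runs p s t' s' :=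
  let ⟨tr, he, ho, hl⟩ := h; ⟨tr, he, ho, hl.trans ht⟩

theorem Runs.copy (s : Store) (x y : ℕ) :
    Runs (.copy x y) s 1 (Function.update s x (s y)) := ⟨_, .copy s x y, rfl, le_rfl⟩

theorem Runs.snd (s : Store) (x y : ℕ) :
    Runs (.snd x y) s 1 (Function.update s x (s y).snd) := ⟨_, .snd s x y, rfl, le_rfl⟩

/-- A loop over the linked list in the variable `x`. -/
theorem Runs.loop {p : Prog} {x t : ℕ} (P : ℕ → Store → Prop)
    (hp : ∀ k s a l, P k s → s x = .cons a (Data.ofList l) →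
      ∃ s', Runs p s t s' ∧ P (k + 1) s' ∧ s' x = Data.ofList l) :
    ∀ (l : List Data) (k : ℕ) (s : Store), P k s → s x = Data.ofList l →
      ∃ s', Runs (.loop x p) s (l.length * (t + 1) + 1) s' ∧ P (k + l.length) s' := by
  intro l
  induction l with
  | nil => exact fun k s hP hs => ⟨s, ⟨_, .loop_done hs, rfl, by simp⟩, hP⟩
  | cons a l ih =>
    intro k s hP hs
    obtain ⟨s', ⟨tr, he, ho, hl⟩, hP', hs'⟩ := hp k s a l hP hs
    obtain ⟨s'', ⟨tr', he', ho', hl'⟩, hP''⟩ := ih (k + 1) s' hP' hs'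
    refine ⟨s'', ⟨_, .loop_step (by rw [hs]; exact Data.noConfusion) he he', ?_, ?_⟩, ?_⟩
    · rw [outputs_tick, outputs_append, ho, ho', List.append_nil]
    · simp only [List.length_cons, List.length_append]
      linarith
    · convert hP'' using 1
      simp only [List.length_cons]
      omega

/-- The input sits in its two variables. -/
def HasInput (c : Input) (s : Store) : Prop :=
  s 0 = encodeGraph c.graph ∧ s 1 = encodeSet c.terminals

theorem HasInput.congr {c : Input} {s s' : Store} (h : HasInput c s) (h0 : s' 0 = s 0)
    (h1 : s' 1 = s 1) : HasInput c s' := ⟨h0.trans h.1, h1.trans h.2⟩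

theorem Fn.runs (c : Input) (f : Fn) : ∀ (d : ℕ) (s : Store), 2 ≤ d → HasInput c s →
    ∃ s', Runs (f.compile d) s (f.time.eval c.n) s' ∧ s' d = f.eval c (s d) ∧
      ∀ x < d, s' x = s x := by
  have base : ∀ {p : Prog} {s : Store} {d : ℕ} {v : Data} {e : Event}, outputs [e] = [] →
      Exec p s [e] (Function.update s d v) →
      ∃ s', Runs p s ((1 : Polynomial ℕ).eval c.n) s' ∧ s' d = v ∧ ∀ x < d, s' x = s x :=
    fun he h => ⟨_, ⟨_, h, he, by simp⟩, by simp,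
      fun x hx => Function.update_of_ne hx.ne _ _⟩
  induction f with
  | id =>
    exact fun d s _ _ => ⟨s, ⟨_, .skip s, rfl, by simp [Fn.time]⟩, rfl, fun _ _ => rfl⟩
  | nil => exact fun d s _ _ => base rfl (.setNil s d)
  | graph =>
    intro d s _ hs
    have := base (d := d) rfl (.copy s d 0)
    rw [hs.1] at this
    exact this
  | terminals =>
    intro d s _ hs
    have := base (d := d) rfl (.copy s d 1)
    rw [hs.2] at this
    exact this
  | fst => exact fun d s _ _ => base rfl (.fst s d d)
  | snd => exact fun d s _ _ => base rfl (.snd s d d)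
  | comp g f ihg ihf =>
    intro d s hd hs
    obtain ⟨s₁, r₁, v₁, e₁⟩ := ihf d s hd hs
    obtain ⟨s₂, r₂, v₂, e₂⟩ := ihg d s₁ hd (hs.congr (e₁ 0 (by omega)) (e₁ 1 (by omega)))
    refine ⟨s₂, (r₁.seq r₂).mono ?_, ?_, fun x hx => (e₂ x hx).trans (e₁ x hx)⟩
    · simp [Fn.time]
    · rw [v₂, v₁]; rfl
  | pair f g ihf ihg =>
    intro d s hd hs
    obtain ⟨s₁, r₁, v₁, e₁⟩ := ihf (d + 1) (Function.update s (d + 1) (s d)) (by omega)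
      (hs.congr (Function.update_of_ne (by omega) _ _) (Function.update_of_ne (by omega) _ _))
    have e₁' : ∀ x ≤ d, s₁ x = s x := fun x hx =>
      (e₁ x (by omega)).trans (Function.update_of_ne (by omega) _ _)
    obtain ⟨s₂, r₂, v₂, e₂⟩ := ihg (d + 2) (Function.update s₁ (d + 2) (s₁ d)) (by omega)
      (hs.congr ((Function.update_of_ne (by omega) _ _).trans (e₁' 0 (by omega)))
        ((Function.update_of_ne (by omega) _ _).trans (e₁' 1 (by omega))))
    have e₂' : ∀ x ≤ d + 1, s₂ x = s₁ x := fun x hx =>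
      (e₂ x (by omega)).trans (Function.update_of_ne (by omega) _ _)
    refine ⟨_, (Runs.seq (.copy s _ _) (r₁.seq (Runs.seq (.copy s₁ _ _) (r₂.seq
      ⟨_, .cons s₂ d (d + 1) (d + 2), rfl, le_rfl⟩)))).mono ?_, ?_, fun x hx => ?_⟩
    · simp only [Fn.time, Polynomial.eval_add, Polynomial.eval_ofNat, List.length_singleton]
      omega
    · rw [Function.update_self, v₂, e₂' _ le_rfl, v₁, Function.update_self, Function.update_self,
        e₁' d le_rfl]
      rfl
    · rw [Function.update_of_ne (by omega), e₂' x (by omega), e₁' x (by omega)]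
  | ite t f g iht ihf ihg =>
    intro d s hd hs
    obtain ⟨s₁, r₁, v₁, e₁⟩ := iht (d + 1) (Function.update s (d + 1) (s d)) (by omega)
      (hs.congr (Function.update_of_ne (by omega) _ _) (Function.update_of_ne (by omega) _ _))
    rw [Function.update_self] at v₁
    have e₁' : ∀ x ≤ d, s₁ x = s x := fun x hx =>
      (e₁ x (by omega)).trans (Function.update_of_ne (by omega) _ _)
    have hs₁ := hs.congr (e₁' 0 (by omega)) (e₁' 1 (by omega))
    by_cases ht : t.eval c (s d) = .nil
    · obtain ⟨s₂, ⟨tr, r₂, o₂, l₂⟩, v₂, e₂⟩ := ihg d s₁ hd hs₁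
      refine ⟨s₂, (Runs.seq (.copy s _ _) (r₁.seq ⟨_, .ite_false (v₁.trans ht) r₂, o₂, ?_⟩)).mono
        (t := _ + (_ + (g.time.eval c.n + 1))) ?_, ?_, fun x hx => ?_⟩
      · rw [List.length_cons]; omega
      · simp only [Fn.time, Polynomial.eval_add, Polynomial.eval_ofNat]
        omega
      · rw [v₂, e₁' d le_rfl, Fn.eval, if_neg (not_not.2 ht)]
      · rw [e₂ x hx, e₁' x hx.le]
    · obtain ⟨s₂, ⟨tr, r₂, o₂, l₂⟩, v₂, e₂⟩ := ihf d s₁ hd hs₁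
      refine ⟨s₂, (Runs.seq (.copy s _ _) (r₁.seq ⟨_, .ite_true (v₁ ▸ ht) r₂, o₂, ?_⟩)).mono
        (t := _ + (_ + (f.time.eval c.n + 1))) ?_, ?_, fun x hx => ?_⟩
      · rw [List.length_cons]; omega
      · simp only [Fn.time, Polynomial.eval_add, Polynomial.eval_ofNat]
        omega
      · rw [v₂, e₁' d le_rfl, Fn.eval, if_pos ht]
      · rw [e₂ x hx, e₁' x hx.le]
  | iter f ih =>
    intro d s hd hs
    set s₁ := Function.update s (d + 1) (s d) with hs₁
    set s₂ := Function.update s₁ d (s₁ 0) with hs₂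
    have e₂ : ∀ x < d, s₂ x = s x := fun x hx => by
      rw [hs₂, Function.update_of_ne (by omega), hs₁, Function.update_of_ne (by omega)]
    obtain ⟨s₃, r₃, v₃, e₃⟩ := Runs.loop (p := .seq (.snd d d) (f.compile (d + 1))) (x := d)
      (t := 1 + f.time.eval c.n)
      (fun k s' => s' (d + 1) = (f.eval c)^[k] (s d) ∧ ∀ x < d, s' x = s x)
      (by
        rintro k s' a l ⟨hv, he⟩ hl
        obtain ⟨s'', r, v, e⟩ := ih (d + 1) (Function.update s' d (s' d).snd) (by omega)
          (hs.congr ((Function.update_of_ne (by omega) _ _).trans (he 0 (by omega)))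
            ((Function.update_of_ne (by omega) _ _).trans (he 1 (by omega))))
        refine ⟨s'', (Runs.snd s' d d).seq r, ⟨?_, fun x hx => ?_⟩, ?_⟩
        · rw [v, Function.update_of_ne (by omega), hv, Function.iterate_succ_apply']
        · rw [e x (by omega), Function.update_of_ne (by omega), he x hx]
        · rw [e d (by omega), Function.update_self, hl]; rfl)
      (List.ofFn fun i => encodeSet {j | c.graph.Adj i j}) 0 s₂
      ⟨by rw [hs₂, Function.update_of_ne (by omega), hs₁, Function.update_self]; rfl, e₂⟩
      (by rw [hs₂, Function.update_self, hs₁, Function.update_of_ne (by omega), hs.1]; rfl)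
    rw [List.length_ofFn] at r₃ v₃
    refine ⟨_, (Runs.seq (.copy s _ _) (Runs.seq (.copy s₁ _ _) (r₃.seq (.copy s₃ _ _)))).mono ?_,
      ?_, fun x hx => ?_⟩
    · simp only [Fn.time, Polynomial.eval_add, Polynomial.eval_mul, Polynomial.eval_X,
        Polynomial.eval_ofNat]
      linarith
    · rw [Function.update_self, v₃, Nat.zero_add]; rfl
    · rw [Function.update_of_ne (by omega), e₃ x hx]


/-! ### Computability from an environment -/

/-- In each of the situations `i : I`, the datum `F i` is obtained from the datum `env i` and the
input `c i` by one and the same expression. -/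
def Comp {I : Type} (c : I → Input) (env F : I → Data) : Prop :=
  ∃ f : Fn, ∀ i, f.eval (c i) (env i) = F i

namespace Comp

variable {I J : Type} {c : I → Input} {env F F' : I → Data}

theorem refl : Comp c env env := ⟨.id, fun _ => rfl⟩

theorem trans (h : Comp c env F) (h' : Comp c F F') : Comp c env F' := by
  obtain ⟨f, hf⟩ := h
  obtain ⟨g, hg⟩ := h'
  exact ⟨.comp g f, fun i => by rw [Fn.eval, hf, hg]⟩

theorem congr (h : Comp c env F) (hF : ∀ i, F i = F' i) : Comp c env F' :=
  funext hF ▸ h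

theorem nil : Comp c env fun _ => .nil := ⟨.nil, fun _ => rfl⟩

theorem graph : Comp c env fun i => encodeGraph (c i).graph := ⟨.graph, fun _ => rfl⟩

theorem terminals : Comp c env fun i => encodeSet (c i).terminals := ⟨.terminals, fun _ => rfl⟩

theorem cons (h : Comp c env F) (h' : Comp c env F') :
    Comp c env fun i => .cons (F i) (F' i) := by
  obtain ⟨f, hf⟩ := h
  obtain ⟨g, hg⟩ := h'
  exact ⟨.pair f g, fun i => by rw [Fn.eval, hf, hg]⟩

theorem fst (h : Comp c env F) : Comp c env fun i => (F i).fst :=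
  h.trans ⟨.fst, fun _ => rfl⟩

theorem snd (h : Comp c env F) : Comp c env fun i => (F i).snd :=
  h.trans ⟨.snd, fun _ => rfl⟩

/-- Situations can be mapped. -/
theorem comap (h : Comp c env F) (g : J → I) :
    Comp (fun j => c (g j)) (fun j => env (g j)) fun j => F (g j) :=
  let ⟨f, hf⟩ := h; ⟨f, fun j => hf (g j)⟩

/-- What is computable stays so when a bound variable `x` is added to the environment. -/
theorem weaken (h : Comp c env F) (g : J → I) (x : J → Data) :
    Comp (fun j => c (g j)) (fun j => .cons (env (g j)) (x j)) fun j => F (g j) :=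
  (refl.fst : Comp _ (fun j => Data.cons (env (g j)) (x j)) _).trans (h.comap g)

/-- The bound variable is computable. -/
theorem bound {x : I → Data} : Comp c (fun i => .cons (env i) (x i)) x := refl.snd

theorem ite {P : I → Prop} [DecidablePred P] {t : I → Data}
    (ht : Comp c env t) (htP : ∀ i, t i ≠ .nil ↔ P i)
    (h : Comp c env F) (h' : Comp c env F') :
    Comp c env fun i => if P i then F i else F' i := by
  obtain ⟨t, ht⟩ := ht
  obtain ⟨f, hf⟩ := h
  obtain ⟨g, hg⟩ := h'
  refine ⟨.ite t f g, fun i => ?_⟩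
  rw [Fn.eval, ht, hf, hg]
  simp only [htP]

theorem bit_ne_nil {p : Prop} : bit p ≠ .nil ↔ p := by
  unfold bit
  split_ifs with h <;> simp [h]

theorem ite_bit {P : I → Prop} [DecidablePred P]
    (hP : Comp c env fun i => bit (P i)) (h : Comp c env F)
    (h' : Comp c env F') : Comp c env fun i => if P i then F i else F' i :=
  hP.ite (fun _ => bit_ne_nil) h h'

theorem bit_of {P : I → Prop} {t : I → Data} (ht : Comp c env t) (htP : ∀ i, t i ≠ .nil ↔ P i) :
    Comp c env fun i => bit (P i) := by
  classical exact (ht.ite htP (nil.cons nil) nil).congr fun _ => rfl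

theorem not {P : I → Prop} (hP : Comp c env fun i => bit (P i)) :
    Comp c env fun i => bit (¬ P i) := by
  classical
  exact (hP.ite_bit nil (nil.cons nil)).congr fun i => by
    by_cases h : P i <;> simp [bit, h]

theorem and {P Q : I → Prop} (hP : Comp c env fun i => bit (P i))
    (hQ : Comp c env fun i => bit (Q i)) : Comp c env fun i => bit (P i ∧ Q i) := by
  classical
  exact (hP.ite_bit hQ nil).congr fun i => by
    by_cases h : P i <;> by_cases h' : Q i <;> simp [bit, h, h']

theorem or {P Q : I → Prop} (hP : Comp c env fun i => bit (P i))
    (hQ : Comp c env fun i => bit (Q i)) : Comp c env fun i => bit (P i ∨ Q i) := by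
  classical
  exact (hP.ite_bit (nil.cons nil) hQ).congr fun i => by
    by_cases h : P i <;> by_cases h' : Q i <;> simp [bit, h, h']

theorem imp {P Q : I → Prop} (hP : Comp c env fun i => bit (P i))
    (hQ : Comp c env fun i => bit (Q i)) : Comp c env fun i => bit (P i → Q i) :=
  (hP.not.or hQ).congr fun _ => by rw [imp_iff_not_or]

/-- If each step from `st i k` to `st i (k + 1)` is computable, so is the result of `n` steps. -/
theorem iter {st : (i : I) → ℕ → Data} (h : Comp c env fun i => st i 0)
    (hst : Comp (fun j : Σ i, Fin (c i).n => c j.1)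
      (fun j => .cons (env j.1) (st j.1 j.2)) fun j => st j.1 (j.2 + 1)) :
    Comp c env fun i => st i (c i).n := by
  obtain ⟨f, hf⟩ := h
  obtain ⟨g, hg⟩ := hst
  refine ⟨.comp .snd (.comp (.iter (.pair .fst g)) (.pair .id f)), fun i => ?_⟩
  have key : ∀ k ≤ (c i).n, ((Fn.pair .fst g).eval (c i))^[k] (.cons (env i) (st i 0)) =
      .cons (env i) (st i k) := by
    intro k hk
    induction k with
    | zero => rfl
    | succ k ih =>
      rw [Function.iterate_succ_apply', ih (by omega)]
      exact congrArg (Data.cons (env i)) (hg ⟨i, k, hk⟩)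
  simp only [Fn.eval, hf]
  exact congrArg Data.snd (key _ le_rfl)

end Comp

/-! ### Vertices, vertex sets and quantifiers -/

/-- Numbers in unary, as linked lists. -/
def unary (k : ℕ) : Data := .ofList (List.replicate k .nil)

theorem unary_ne_nil {k : ℕ} : unary k ≠ .nil ↔ 0 < k := by
  cases k <;> simp [unary, Data.ofList, List.replicate_succ]

theorem unary_snd (k : ℕ) : (unary k).snd = unary (k - 1) := by
  cases k <;> rfl

theorem ofList_snd (l : List Data) : (Data.ofList l).snd = .ofList (l.drop 1) := by
  cases l <;> rfl

namespace Comp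

variable {I : Type} {c : I → Input} {env F F' : I → Data}

/-- The situations in which a vertex has been chosen. -/
abbrev WithVertex (c : I → Input) : Type := Σ i, Fin (c i).n

/-- The environment extended by the chosen vertex. -/
def bind (c : I → Input) (env : I → Data) (j : WithVertex c) : Data :=
  .cons (env j.1) (unary j.2)

/-- What is computable stays so when a vertex is chosen. -/
theorem up (h : Comp c env F) : Comp (fun j : WithVertex c => c j.1) (bind c env) fun j => F j.1 :=
  h.weaken Sigma.fst _

/-- The chosen vertex is computable. -/
theorem var : Comp (fun j : WithVertex c => c j.1) (bind c env) fun j => unary j.2 := bound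

/-- The situations in which a vertex has been chosen and a loop is in a certain state. -/
abbrev WithState (c : I → Input) (σ : I → Type) : Type := Σ i, Fin (c i).n × σ i

/-- The environment extended by the chosen vertex and the state. -/
def bindState (c : I → Input) (env : I → Data) {σ : I → Type} (enc : (i : I) → σ i → Data)
    (j : WithState c σ) : Data :=
  .cons (.cons (env j.1) (unary j.2.1)) (enc j.1 j.2.2)

section

variable {σ : I → Type} {enc : (i : I) → σ i → Data}

theorem upState (h : Comp c env F) :
    Comp (fun j : WithState c σ => c j.1) (bindState c env enc) fun j => F j.1 :=
  refl.fst.fst.trans (h.comap Sigma.fst)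

theorem varState :
    Comp (fun j : WithState c σ => c j.1) (bindState c env enc) fun j => unary j.2.1 :=
  refl.fst.snd

theorem state :
    Comp (fun j : WithState c σ => c j.1) (bindState c env enc) fun j => enc j.1 j.2.2 :=
  refl.snd

end

theorem unary_n : Comp c env fun i => unary (c i).n :=
  iter (st := fun _ k => unary k) nil (nil.cons bound)

theorem drop {L : I → List Data} {k : I → ℕ} (hL : Comp c env fun i => .ofList (L i))
    (hk : Comp c env fun i => unary (k i)) (hn : ∀ i, k i ≤ (c i).n) :
    Comp c env fun i => .ofList ((L i).drop (k i)) := by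
  have := (iter (st := fun i m => .cons (unary (k i - m)) (.ofList ((L i).drop (min m (k i)))))
    ((hk.cons hL).congr fun i => by simp) ?_).snd
  · exact this.congr fun i => by simp [Data.snd, hn i]
  · refine (bound.fst.snd.cons (bound.fst.ite (P := fun j : WithVertex c => j.2.1 < k j.1)
      (fun j => ?_) bound.snd.snd bound.snd)).congr fun j => ?_
    · exact unary_ne_nil.trans Nat.sub_pos_iff_lt
    · change Data.cons (unary _).snd (if _ then (Data.ofList _).snd else Data.ofList _) = _
      rw [unary_snd, ofList_snd, List.drop_drop]
      congr 1
      split_ifs with h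
      · congr 2
        omega
      · congr 2
        omega

theorem lookup {x : (i : I) → Fin (c i).n → Data} {v : (i : I) → Fin (c i).n}
    (hx : Comp c env fun i => .ofList (List.ofFn (x i))) (hv : Comp c env fun i => unary (v i)) :
    Comp c env fun i => x i (v i) :=
  (hx.drop hv fun i => (v i).2.le).fst.congr fun i => by
    rw [List.drop_eq_getElem_cons (by simp)]
    simp [Data.ofList, Data.fst]

theorem ofFn {x : (i : I) → Fin (c i).n → Data}
    (hx : Comp (fun j : WithVertex c => c j.1) (bind c env) fun j => x j.1 j.2) :
    Comp c env fun i => .ofList (List.ofFn (x i)) := by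
  have key := iter (c := c) (env := env) (st := fun i m => .cons (unary ((c i).n - m))
    (.ofList ((List.ofFn (x i)).drop ((c i).n - m)))) ((unary_n.cons nil).congr fun i => ?_) ?_
  · exact key.snd.congr fun i => by simp [Data.snd]
  · rw [Nat.sub_zero, List.drop_eq_nil_of_le (by simp)]
    rfl
  · -- the list is built from its end, so the element with index `n - (m + 1)` is added next
    have hu : Comp (fun j : WithVertex c => c j.1) (fun j => .cons (env j.1)
        (.cons (unary ((c j.1).n - j.2)) (.ofList ((List.ofFn (x j.1)).drop ((c j.1).n - j.2)))))
        fun j => unary ((c j.1).n - (j.2 + 1)) :=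
      bound.fst.snd.congr fun j => unary_snd _
    have hx' := Comp.trans (refl.fst.cons hu) ((hx.comap fun j : WithVertex c =>
      (⟨j.1, j.2.rev⟩ : WithVertex c)))
    refine (hu.cons (hx'.cons bound.snd)).congr fun ⟨i, m⟩ => ?_
    dsimp only
    congr 1
    have hm : (c i).n - m.1 = (c i).n - (m.1 + 1) + 1 := by have := m.2; omega
    have hlt : (c i).n - (m.1 + 1) < (List.ofFn (x i)).length := by
      have := m.2; rw [List.length_ofFn]; omega
    rw [List.drop_eq_getElem_cons hlt, ← hm, List.getElem_ofFn]
    rfl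

/-- A vertex set is computable if its membership predicate is. -/
theorem setOf {P : (i : I) → Fin (c i).n → Prop}
    (hP : Comp (fun j : WithVertex c => c j.1) (bind c env) fun j => bit (P j.1 j.2)) :
    Comp c env fun i => encodeSet {v | P i v} :=
  ofFn hP

theorem mem {v : (i : I) → Fin (c i).n} {S : (i : I) → Set (Fin (c i).n)}
    (hv : Comp c env fun i => unary (v i)) (hS : Comp c env fun i => encodeSet (S i)) :
    Comp c env fun i => bit (v i ∈ S i) :=
  lookup (x := fun i v => bit (v ∈ S i)) hS hv

theorem adj {v w : (i : I) → Fin (c i).n} (hv : Comp c env fun i => unary (v i))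
    (hw : Comp c env fun i => unary (w i)) :
    Comp c env fun i => bit ((c i).graph.Adj (v i) (w i)) :=
  mem hw (S := fun i => {w | (c i).graph.Adj (v i) w})
    (lookup (x := fun i v => encodeSet {w | (c i).graph.Adj v w}) graph hv)

theorem lt {v w : (i : I) → Fin (c i).n} (hv : Comp c env fun i => unary (v i))
    (hw : Comp c env fun i => unary (w i)) : Comp c env fun i => bit (v i < w i) :=
  bit_of (drop (L := fun i => List.replicate (w i) .nil) hw hv fun i => (v i).2.le) fun i => by
    rw [List.drop_replicate]
    exact unary_ne_nil.trans Nat.sub_pos_iff_lt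

theorem eq {v w : (i : I) → Fin (c i).n} (hv : Comp c env fun i => unary (v i))
    (hw : Comp c env fun i => unary (w i)) : Comp c env fun i => bit (v i = w i) :=
  ((hv.lt hw).not.and (hw.lt hv).not).congr fun i => by
    rw [not_lt, not_lt, and_comm, ← le_antisymm_iff]

/-- Iteration over the vertices: the step from `st i v` to `st i (v + 1)` may use `v`. -/
theorem iter_vertex {st : (i : I) → ℕ → Data} (h : Comp c env fun i => st i 0)
    (hst : Comp (fun j : WithVertex c => c j.1)
      (fun j => .cons (bind c env j) (st j.1 j.2)) fun j => st j.1 (j.2 + 1)) :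
    Comp c env fun i => st i (c i).n :=
  (iter (c := c) (env := env) (st := fun i m => .cons (unary m) (st i m)) (nil.cons h)
    ((nil.cons bound.fst).cons (Comp.trans
      (F := fun j => .cons (bind c env j) (st j.1 j.2))
      ((refl.fst.cons bound.fst).cons bound.snd) hst))).snd

/-- A fold over all vertices is computable if its step is; `enc` says how states are stored. -/
theorem fold {σ : I → Type} {enc : (i : I) → σ i → Data}
    {step : (i : I) → Fin (c i).n → σ i → σ i} {init : (i : I) → σ i}
    (h : Comp c env fun i => enc i (init i))
    (hstep : Comp (fun j : WithState c σ => c j.1) (bindState c env enc)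
      fun j => enc j.1 (step j.1 j.2.1 j.2.2)) :
    Comp c env fun i => enc i ((List.finRange (c i).n).foldl (fun s k => step i k s) (init i)) := by
  set S : (i : I) → ℕ → σ i := fun i m =>
    ((List.finRange (c i).n).take m).foldl (fun s k => step i k s) (init i) with hS
  refine (iter_vertex (c := c) (env := env) (st := fun i m => enc i (S i m)) h ?_).congr
    fun i => ?_
  · refine (hstep.comap fun j : WithVertex c => ⟨j.1, j.2, S j.1 j.2⟩).congr fun ⟨i, m⟩ => ?_
    have : S i (m + 1) = step i m (S i m) := by
      simp only [hS]
      rw [List.take_add_one, List.foldl_append]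
      simp
    exact congrArg (enc i) this.symm
  · simp only [hS]
    rw [List.take_of_length_le (by simp)]

theorem exists_vertex {P : (i : I) → Fin (c i).n → Prop}
    (hP : Comp (fun j : WithVertex c => c j.1) (bind c env) fun j => bit (P j.1 j.2)) :
    Comp c env fun i => bit (∃ v, P i v) := by
  have key := fold (c := c) (env := env) (σ := fun _ => Prop) (enc := fun _ => bit)
    (step := fun i v p => p ∨ P i v) (init := fun _ => False)
    (nil.congr fun i => by simp [bit])
    (state.or ((hP.comap fun j : WithState c _ => ⟨j.1, j.2.1⟩).weaken id _))
  refine key.congr fun i => congrArg bit (propext ?_)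
  have : ∀ (l : List (Fin (c i).n)) (p : Prop),
      l.foldl (fun p v => p ∨ P i v) p ↔ p ∨ ∃ v ∈ l, P i v := by
    intro l
    induction l with
    | nil => simp
    | cons a l ih => intro p; rw [List.foldl_cons, ih]; simp [or_assoc]
  rw [this]
  simp

theorem forall_vertex {P : (i : I) → Fin (c i).n → Prop}
    (hP : Comp (fun j : WithVertex c => c j.1) (bind c env) fun j => bit (P j.1 j.2)) :
    Comp c env fun i => bit (∀ v, P i v) :=
  (exists_vertex (P := fun i v => ¬ P i v) hP.not).not.congr fun i => by push Not; rfl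

end Comp

/-! ### Minimal connections by greedy deletion -/

section Greedy

variable {n : ℕ} {G : SimpleGraph (Fin n)}

/-- The vertices that can be reached from `a` inside `X` in at most `k` steps. -/
def reachWithin (G : SimpleGraph (Fin n)) (X : Set (Fin n)) (a : Fin n) : ℕ → Set (Fin n)
  | 0 => {x | x = a ∧ x ∈ X}
  | k + 1 => {x | x ∈ X ∧ (x ∈ reachWithin G X a k ∨ ∃ y, y ∈ reachWithin G X a k ∧ G.Adj y x)}

theorem joined_of_mem_reachWithin {X : Set (Fin n)} {a x : Fin n} {k : ℕ}
    (hx : x ∈ reachWithin G X a k) : Joined G X a x := by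
  induction k generalizing x with
  | zero => obtain ⟨rfl, h⟩ := hx; exact .refl h
  | succ k ih =>
    obtain ⟨hxX, hx | ⟨y, hy, hyx⟩⟩ := hx
    exacts [ih hx, (ih hy).step hxX hyx]

theorem reachWithin_n {X : Set (Fin n)} {a : Fin n} :
    reachWithin G X a n = {x | Joined G X a x} := by
  classical
  refine Set.Subset.antisymm (fun x => joined_of_mem_reachWithin) ?_
  rintro x ⟨ha, hx, ⟨p⟩⟩
  have hwalk : ∀ (y z : X) (q : (G.induce X).Walk y z) (k : ℕ), y.1 ∈ reachWithin G X a k →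
      z.1 ∈ reachWithin G X a (k + q.length) := by
    intro y z q
    induction q with
    | nil => exact fun k hk => hk
    | @cons y y' z h q ih =>
      intro k hk
      have := ih (k + 1) ⟨y'.2, .inr ⟨y, hk, by simpa using h⟩⟩
      rwa [SimpleGraph.Walk.length_cons, ← Nat.add_assoc, Nat.add_right_comm]
  have hmono : ∀ k l, reachWithin G X a k ⊆ reachWithin G X a (k + l) := by
    intro k l
    induction l with
    | zero => exact subset_rfl
    | succ l ih =>
      exact fun y hy => ⟨(joined_of_mem_reachWithin hy).2.1, .inl (ih hy)⟩
  have hlt := p.bypass_isPath.length_lt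
  have hcard : Fintype.card X ≤ n := by simpa using Fintype.card_subtype_le (· ∈ X)
  have h := hmono _ (n - p.bypass.length) (hwalk _ _ p.bypass 0 ⟨rfl, ha⟩)
  rwa [Nat.zero_add, Nat.add_sub_cancel' (by omega)] at h

open Classical in
/-- Delete vertices from `U` one after the other, as long as the terminals `T` stay connected. -/
noncomputable def greedy (G : SimpleGraph (Fin n)) (U T : Set (Fin n)) : Set (Fin n) :=
  (List.finRange n).foldl
    (fun S v => if IsInducedSteiner G T (S \ {v}) then S \ {v} else S) U

theorem greedy_spec {U T : Set (Fin n)} (h : IsInducedSteiner G T U) :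
    greedy G U T ⊆ U ∧ IsMinimalInducedSteiner G T (greedy G U T) := by
  classical
  have key : ∀ (l : List (Fin n)) (U : Set (Fin n)), IsInducedSteiner G T U →
      ∀ R, R = l.foldl (fun S v => if IsInducedSteiner G T (S \ {v}) then S \ {v} else S) U →
      R ⊆ U ∧ IsInducedSteiner G T R ∧ ∀ v ∈ l, v ∈ R → ¬ IsInducedSteiner G T (R \ {v}) := by
    intro l
    induction l with
    | nil => rintro U hU R rfl; exact ⟨subset_rfl, hU, by simp⟩
    | cons a l ih =>
      intro U hU R hR
      rw [List.foldl_cons] at hR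
      split_ifs at hR with ha
      · obtain ⟨h1, h2, h3⟩ := ih _ ha R hR
        refine ⟨h1.trans Set.sdiff_subset, h2, fun v hv hvR => ?_⟩
        rcases List.mem_cons.1 hv with rfl | hv
        · exact absurd rfl (h1 hvR).2
        · exact h3 v hv hvR
      · obtain ⟨h1, h2, h3⟩ := ih _ hU R hR
        refine ⟨h1, h2, fun v hv hvR => ?_⟩
        rcases List.mem_cons.1 hv with rfl | hv
        · exact fun h => ha (h.mono (Set.sdiff_subset_sdiff_left h1))
        · exact h3 v hv hvR
  obtain ⟨h1, h2, h3⟩ := key _ U h _ rfl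
  refine ⟨h1, h2, fun S hS hSR x hx => ?_⟩
  by_contra hxS
  exact h3 x (List.mem_finRange x) hx
    (hS.mono fun y hy => ⟨hSR hy, fun hyx => hxS (Set.mem_singleton_iff.1 hyx ▸ hy)⟩)

theorem isMinimizer_greedy : IsMinimizer G (greedy G) := fun _ _ hT hU =>
  greedy_spec ⟨hT, fun _ _ => hU.preconnected _ _⟩

end Greedy

namespace Comp

variable {I : Type} {c : I → Input} {env F F' : I → Data}

theorem component {X : (i : I) → Set (Fin (c i).n)} {a : (i : I) → Fin (c i).n}
    (hX : Comp c env fun i => encodeSet (X i)) (ha : Comp c env fun i => unary (a i)) :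
    Comp c env fun i => encodeSet {x | Joined (c i).graph (X i) (a i) x} := by
  refine (iter (c := c) (env := env)
    (st := fun i k => encodeSet (reachWithin (c i).graph (X i) (a i) k)) ?_ ?_).congr
      fun i => by rw [reachWithin_n]
  · exact setOf ((var.eq ha.up).and (var.mem hX.up))
  · have hX' := hX.weaken (J := WithVertex c) Sigma.fst
      fun j => encodeSet (reachWithin (c j.1).graph (X j.1) (a j.1) j.2)
    exact setOf ((var.mem hX'.up).and ((var.mem bound.up).or
      (exists_vertex ((var.mem bound.up.up).and (var.adj var.up)))))

theorem subset {S T : (i : I) → Set (Fin (c i).n)} (hS : Comp c env fun i => encodeSet (S i))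
    (hT : Comp c env fun i => encodeSet (T i)) : Comp c env fun i => bit (S i ⊆ T i) :=
  forall_vertex (P := fun i v => v ∈ S i → v ∈ T i) ((var.mem hS.up).imp (var.mem hT.up))

theorem isInducedSteiner {T U : (i : I) → Set (Fin (c i).n)}
    (hT : Comp c env fun i => encodeSet (T i)) (hU : Comp c env fun i => encodeSet (U i)) :
    Comp c env fun i => bit (IsInducedSteiner (c i).graph (T i) (U i)) :=
  ((hT.subset hU).and (forall_vertex ((var.mem hT.up).imp (forall_vertex
    ((var.mem hT.up.up).imp (var.mem (component hU.up var).up)))))).congr fun i => by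
      rw [isInducedSteiner_iff]

theorem union {S T : (i : I) → Set (Fin (c i).n)} (hS : Comp c env fun i => encodeSet (S i))
    (hT : Comp c env fun i => encodeSet (T i)) : Comp c env fun i => encodeSet (S i ∪ T i) :=
  setOf ((var.mem hS.up).or (var.mem hT.up))

theorem inter {S T : (i : I) → Set (Fin (c i).n)} (hS : Comp c env fun i => encodeSet (S i))
    (hT : Comp c env fun i => encodeSet (T i)) : Comp c env fun i => encodeSet (S i ∩ T i) :=
  setOf ((var.mem hS.up).and (var.mem hT.up))

theorem sdiff {S T : (i : I) → Set (Fin (c i).n)} (hS : Comp c env fun i => encodeSet (S i))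
    (hT : Comp c env fun i => encodeSet (T i)) : Comp c env fun i => encodeSet (S i \ T i) :=
  setOf ((var.mem hS.up).and (var.mem hT.up).not)

theorem singleton {v : (i : I) → Fin (c i).n} (hv : Comp c env fun i => unary (v i)) :
    Comp c env fun i => encodeSet {v i} :=
  setOf (var.eq hv.up)

theorem greedy {U T : (i : I) → Set (Fin (c i).n)} (hU : Comp c env fun i => encodeSet (U i))
    (hT : Comp c env fun i => encodeSet (T i)) :
    Comp c env fun i => encodeSet (greedy (c i).graph (U i) (T i)) := by
  classical
  refine fold (σ := fun i => Set (Fin (c i).n)) (enc := fun _ => encodeSet)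
    (step := fun i v S => if IsInducedSteiner (c i).graph (T i) (S \ {v}) then S \ {v} else S)
    hU ?_
  have hS := (state (env := env) (enc := fun i (S : Set (Fin (c i).n)) => encodeSet S)).sdiff
    (singleton varState)
  exact ((hT.upState.isInducedSteiner hS).ite_bit hS state).congr fun j => (apply_ite _ _ _ _).symm

end Comp

/-! ### Rerouting by greedy deletion -/

section Candidate

variable {n : ℕ}

/-- The vertices that a path from `w` to `u` may use when it has to avoid `v` and to keep away from
`S`. -/
def corridor (G : SimpleGraph (Fin n)) (v w u : Fin n) (S : Set (Fin n)) : Set (Fin n) :=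
  {x | x = w ∨ x = u ∨ ¬ x = v ∧ ∀ y, y ∈ S → ¬ (y = x ∨ G.Adj y x)}

/-- The set that replaces `X` when `v` is removed from it: the two sides are computed for the
component of `a` and the rest, and they are linked by an induced path from `w` to `u`, which is
obtained by greedy deletion as well. -/
noncomputable def candidate (G : SimpleGraph (Fin n)) (W X : Set (Fin n)) (v a w u : Fin n) :
    Set (Fin n) :=
  let C := {x | Joined G (X \ {v}) a x}
  let B := side₂ W (greedy G) ((X \ {v}) \ C)
  side₁ W (greedy G) C w ∪ B ∪ greedy G (corridor G v w u (C ∪ B)) ({w} ∪ {u})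

variable {G : SimpleGraph (Fin n)} {W : Set (Fin n)}

/-- `Z` is obtained from a candidate for `X` by greedy deletion. -/
def Expands (G : SimpleGraph (Fin n)) (W : Set (Fin n)) (X Z : Solution G W) : Prop :=
  ∃ v a w u, IsInducedSteiner G W (candidate G W X.1 v a w u) ∧
    greedy G (candidate G W X.1 v a w u) W = Z.1

/-- A minimal connection of two vertices is an induced path. -/
theorem exists_path_of_minimal {V : Type*} {G : SimpleGraph V} {P : Set V} {w u : V}
    (hP : IsMinimalInducedSteiner G ({w} ∪ {u}) P) :
    ∃ p : G.Walk w u, p.IsPath ∧ {x | x ∈ p.support} = P ∧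
      ∀ q : G.Walk w u, (∀ x ∈ q.support, x ∈ p.support) → p.length ≤ q.length := by
  classical
  have hwalk := ((isInducedSteiner_iff.1 hP.1).2 w (.inl rfl) u (.inr rfl)).exists_walk
  have hex : ∃ l, ∃ p : G.Walk w u, (∀ x ∈ p.support, x ∈ P) ∧ p.length = l :=
    let ⟨p, hp⟩ := hwalk; ⟨_, p, hp, rfl⟩
  obtain ⟨p, hp, hlen⟩ := Nat.find_spec hex
  have hsub : ∀ x ∈ p.bypass.support, x ∈ P := fun x hx =>
    hp x (p.support_bypass_subset_support hx)
  refine ⟨p.bypass, p.bypass_isPath, Set.Subset.antisymm hsub (hP.2 ?_ hsub), fun q hq => ?_⟩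
  · have hj : Joined G {x | x ∈ p.bypass.support} w u := .of_walk _ fun x hx => hx
    rw [isInducedSteiner_iff]
    refine ⟨?_, ?_⟩
    · rintro x (rfl | rfl)
      exacts [hj.1, hj.2.1]
    · rintro x (rfl | rfl) y (rfl | rfl)
      exacts [.refl hj.1, hj, hj.symm, .refl hj.2.1]
  · exact p.length_bypass_le_length.trans
      (hlen ▸ Nat.find_min' hex ⟨q, fun x hx => hsub x (hq x hx), rfl⟩)

/-- The candidates reroute: if `u` is the first vertex of an escape from `w` that is next to the
right side, the corridor contains the escape up to `u`, and the induced path from `w` to `u` that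
greedy deletion finds in it is a chain. -/
theorem expands_reroutes : Reroutes G W (greedy G) (Expands G W) := by
  classical
  intro X v C D hv hs q m hq hqv hsides
  have hA := side₁_spec (W := W) isMinimizer_greedy hs.joinable_left hq.start
  have hB := side₂_spec (W := W) isMinimizer_greedy hs.joinable_right hs.nonempty_right
  obtain ⟨a, ha⟩ := hs.nonempty_left
  have hC := hs.eq_component ha
  have hD : (X.1 \ {v}) \ C = D := by
    rw [← hs.union, Set.union_sdiff_cancel_left (Set.disjoint_iff.1 hs.disjoint)]
  set w := q 0 with hw
  set A := side₁ W (greedy G) C w with hAdef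
  set B := side₂ W (greedy G) D with hBdef
  -- cut the escape off at its first vertex next to `B`
  have hex : ∃ l, q l ∈ nbhd G B := ⟨m, hq.arrive⟩
  have hMm : Nat.find hex ≤ m := Nat.find_min' hex hq.arrive
  have hu := Nat.find_spec hex
  have hlt : ∀ l < Nat.find hex, q l ∉ nbhd G B := fun l hl => Nat.find_min hex hl
  set M := Nat.find hex with hM
  have hqB : ∀ l ≤ M, q l ∉ B := by
    intro l
    induction l with
    | zero =>
      exact fun _ => Set.disjoint_left.1 hsides.disjoint (hsides.minimal_left.subset (.inr rfl))
    | succ l ih =>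
      exact fun hl hlB => hlt l hl ⟨ih (by omega), _, hlB, (hq.adj l (by omega)).symm⟩
  set u := q M with hudef
  set R := corridor G v w u (C ∪ B) with hR
  have hqR : ∀ l ≤ M, q l ∈ R := by
    intro l hl
    rcases hl.lt_or_eq with hl' | rfl
    · rcases Nat.eq_zero_or_pos l with rfl | hl0
      · exact .inl rfl
      · refine .inr (.inr ⟨hqv l (by omega), ?_⟩)
        have haway := hq.away l hl0 (by omega)
        rintro y (hy | hy) (rfl | hadj)
        · exact haway.1 hy
        · exact haway.2 ⟨haway.1, y, hy, hadj⟩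
        · exact hqB l hl hy
        · exact hlt l hl' ⟨hqB l hl, y, hy, hadj⟩
    · exact .inr (.inl rfl)
  have hRS : IsInducedSteiner G ({w} ∪ {u}) R := by
    obtain ⟨p, hp⟩ := exists_walk_of_seq (q := q) (m := M) fun i hi => hq.adj i (by omega)
    have hj : Joined G R w u := .of_walk p fun x hx => by
      obtain ⟨i, hi, rfl⟩ := hp x hx
      exact hqR i hi
    rw [isInducedSteiner_iff]
    refine ⟨?_, ?_⟩
    · rintro x (rfl | rfl)
      exacts [hj.1, hj.2.1]
    · rintro x (rfl | rfl) y (rfl | rfl)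
      exacts [.refl hj.1, hj, hj.symm, .refl hj.2.1]
  obtain ⟨hPR, hP⟩ := greedy_spec hRS
  obtain ⟨p, hp, hpP, hmin⟩ := exists_path_of_minimal hP
  have hpR : ∀ x ∈ p.support, x ∈ R := fun x hx => hPR (hpP ▸ hx)
  have hchain : Chain G A B w p.getVert p.length := by
    refine chain_of_path hp hmin (fun x hx hxw => ?_) hu fun i hi => ?_
    · have hxC : x ∉ C ∧ ∀ y ∈ C, ¬ G.Adj y x := by
        rcases hpR x hx with rfl | rfl | hx'
        · exact absurd rfl hxw
        · have hM0 : 1 ≤ M := Nat.one_le_iff_ne_zero.2 fun h0 => hxw (by rw [hudef, h0])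
          have haway := hq.away M hM0 hMm
          exact ⟨haway.1, fun y hy hadj => haway.2 ⟨haway.1, y, hy, hadj⟩⟩
        · exact ⟨fun h => hx'.2 x (.inl h) (.inl rfl), fun y hy h => hx'.2 y (.inl hy) (.inr h)⟩
      refine ⟨fun hxA => ?_, ?_⟩
      · exact (hA.1 hxA).elim hxC.1 hxw
      · rintro ⟨-, y, hy, hadj⟩
        exact hxC.2 y ((hA.1 hy.1).resolve_right hy.2) hadj
    · have hiu : p.getVert i ≠ u := fun h => by
        have := hp.getVert_injOn (Set.mem_ofPred.2 hi.le) (Set.mem_ofPred.2 le_rfl)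
          (h.trans p.getVert_length.symm)
        omega
      rcases hpR _ (p.getVert_mem_support i) with hx | hx | hx
      · have hM0 : 0 < M := Nat.pos_of_ne_zero fun h0 => hiu (hx.trans (by rw [hudef, h0]))
        rw [hx]
        exact ⟨hqB 0 (Nat.zero_le M), hlt 0 hM0⟩
      · exact absurd hx hiu
      · exact ⟨fun h => hx.2 _ (.inr h) (.inl rfl),
          fun ⟨_, y, hy, hadj⟩ => hx.2 y (.inr hy) (.inr hadj)⟩
  refine ⟨_, _, hchain, fun Z hZ => ⟨v, a, w, u, ?_⟩⟩
  have hcand : candidate G W X.1 v a w u = Z.1 := by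
    rw [hZ, image_getVert_Iic, hpP]
    simp only [candidate, hC, hD]
    rfl
  rw [hcand]
  have hZ' := greedy_spec Z.2.1
  exact ⟨Z.2.1, hZ'.1.antisymm (Z.2.2 hZ'.2.1 hZ'.1)⟩

theorem candidate_comp {I : Type} {c : I → Input} {env : I → Data}
    {X : (i : I) → Set (Fin (c i).n)} {v a w u : (i : I) → Fin (c i).n}
    (hX : Comp c env fun i => encodeSet (X i)) (hv : Comp c env fun i => unary (v i))
    (ha : Comp c env fun i => unary (a i)) (hw : Comp c env fun i => unary (w i))
    (hu : Comp c env fun i => unary (u i)) :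
    Comp c env fun i => encodeSet
      (candidate (c i).graph (c i).terminals (X i) (v i) (a i) (w i) (u i)) := by
  have hXv := hX.sdiff (.singleton hv)
  have hC := hXv.component ha
  have hA : Comp c env fun i => encodeSet (side₁ (c i).terminals (greedy (c i).graph)
      {x | Joined (c i).graph (X i \ {v i}) (a i) x} (w i)) :=
    (hC.union (.singleton hw)).greedy ((Comp.terminals.inter hC).union (.singleton hw))
  have hB : Comp c env fun i => encodeSet (side₂ (c i).terminals (greedy (c i).graph)
      ((X i \ {v i}) \ {x | Joined (c i).graph (X i \ {v i}) (a i) x})) :=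
    (hXv.sdiff hC).greedy (Comp.terminals.inter (hXv.sdiff hC))
  have hR : Comp c env fun i => encodeSet (corridor (c i).graph (v i) (w i) (u i)
      ({x | Joined (c i).graph (X i \ {v i}) (a i) x} ∪ side₂ (c i).terminals (greedy (c i).graph)
        ((X i \ {v i}) \ {x | Joined (c i).graph (X i \ {v i}) (a i) x}))) :=
    .setOf ((Comp.var.eq hw.up).or ((Comp.var.eq hu.up).or ((Comp.var.eq hv.up).not.and
      (.forall_vertex ((Comp.var.mem (hC.union hB).up.up).imp
        ((Comp.var.eq Comp.var.up).or (Comp.var.adj Comp.var.up)).not)))))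
  exact (hA.union hB).union (hR.greedy (.union (.singleton hw) (.singleton hu)))

end Candidate

/-! ### Sets of vertex sets -/

section Trie

/-- The set of the bit strings of length `m` that satisfy `P`, stored as a binary tree; empty
subtrees are `nil`. -/
noncomputable def trie : ℕ → (List Prop → Prop) → Data
  | 0, P => bit (P [])
  | m + 1, P => open Classical in
    if ∃ l, l.length = m + 1 ∧ P l then
      .cons (trie m fun l => P (False :: l)) (trie m fun l => P (True :: l))
    else .nil

theorem trie_eq_nil {m : ℕ} {P : List Prop → Prop} (h : ∀ l, l.length = m → ¬ P l) :
    trie m P = .nil := by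
  cases m with
  | zero => simp [trie, bit, h [] rfl]
  | succ m => exact if_neg (by push Not; exact h)

theorem trie_fst (m : ℕ) (P : List Prop → Prop) :
    (trie (m + 1) P).fst = trie m fun l => P (False :: l) := by
  rw [trie]
  split_ifs with h
  · rfl
  · push Not at h
    exact (trie_eq_nil fun l hl => h _ (by simp [hl])).symm

theorem trie_snd (m : ℕ) (P : List Prop → Prop) :
    (trie (m + 1) P).snd = trie m fun l => P (True :: l) := by
  rw [trie]
  split_ifs with h
  · rfl
  · push Not at h
    exact (trie_eq_nil fun l hl => h _ (by simp [hl])).symm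

variable {n : ℕ}

/-- The characteristic vector of a vertex set. -/
def bits (S : Set (Fin n)) : List Prop := List.ofFn fun v => v ∈ S

theorem bits_injective : Function.Injective (bits (n := n)) := fun S T h => by
  have := List.ofFn_injective h
  ext v
  exact iff_of_eq (congrFun this v)

/-- The predicate on strings that holds for the characteristic vectors of the members of `𝒱`. -/
def IsBits (𝒱 : Set (Set (Fin n))) (l : List Prop) : Prop := ∃ X ∈ 𝒱, bits X = l

/-- A set of vertex sets, stored as a binary tree. -/
noncomputable def encodeFamily (𝒱 : Set (Set (Fin n))) : Data := trie n (IsBits 𝒱)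

/-- The subtree reached from the root by the first `k` bits of `S`. -/
noncomputable def subtrie (𝒱 : Set (Set (Fin n))) (S : Set (Fin n)) (k : ℕ) : Data :=
  trie (n - k) fun l => IsBits 𝒱 ((bits S).take k ++ l)

/-- The subtrees on the path from the root, the last of them first. -/
noncomputable def subtries (𝒱 : Set (Set (Fin n))) (S : Set (Fin n)) : ℕ → Data
  | 0 => .nil
  | k + 1 => .cons (subtrie 𝒱 S k) (subtries 𝒱 S k)

variable {𝒱 : Set (Set (Fin n))} {S : Set (Fin n)}

theorem subtrie_n : subtrie 𝒱 S n = bit (S ∈ 𝒱) := by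
  rw [subtrie, Nat.sub_self, trie, List.append_nil, List.take_of_length_le (by simp [bits])]
  congr 1
  exact propext ⟨fun ⟨X, hX, h⟩ => bits_injective h ▸ hX, fun h => ⟨S, h, rfl⟩⟩

theorem take_succ_bits (v : Fin n) : (bits S).take (v + 1) = (bits S).take v ++ [v ∈ S] := by
  rw [List.take_add_one]
  simp [bits]

open Classical in
theorem subtrie_succ (v : Fin n) : subtrie 𝒱 S (v + 1) =
    if v ∈ S then (subtrie 𝒱 S v).snd else (subtrie 𝒱 S v).fst := by
  have hn : n - v = n - (v + 1) + 1 := by have := v.2; omega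
  rw [subtrie, subtrie, hn, trie_fst, trie_snd, take_succ_bits]
  simp only [List.append_assoc, List.singleton_append]
  split_ifs with h <;> simp [h]

open Classical in
/-- How the path to `S` changes, from its end to the root, when `S` is inserted. -/
theorem subtrie_insert (v : Fin n) : subtrie (insert S 𝒱) S v =
    if v ∈ S then .cons (subtrie 𝒱 S v).fst (subtrie (insert S 𝒱) S (v + 1))
    else .cons (subtrie (insert S 𝒱) S (v + 1)) (subtrie 𝒱 S v).snd := by
  have hn : n - v = n - (v + 1) + 1 := by have := v.2; omega
  have hne : ∃ l, l.length = n - (v + 1) + 1 ∧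
      IsBits (insert S 𝒱) ((bits S).take v ++ l) :=
    ⟨(bits S).drop v, by simp [bits]; omega, S, .inl rfl, (List.take_append_drop _ _).symm⟩
  -- off the path to `S` nothing changes
  have hoff : ∀ (b : Prop), b ≠ (v ∈ S) → ∀ l, IsBits (insert S 𝒱) ((bits S).take v ++ b :: l) =
      IsBits 𝒱 ((bits S).take v ++ b :: l) := by
    intro b hb l
    refine propext ⟨?_, fun ⟨X, hX, h⟩ => ⟨X, .inr hX, h⟩⟩
    rintro ⟨X, rfl | hX, h⟩
    · refine absurd ?_ hb
      have h1 := congrArg (fun l => l[v.1]?) h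
      rw [List.getElem?_append_right (by simp [bits])] at h1
      simpa [bits, eq_comm] using h1
    · exact ⟨X, hX, h⟩
  rw [subtrie, subtrie, subtrie, hn, trie, if_pos hne, trie_fst, trie_snd, take_succ_bits]
  simp only [List.append_assoc, List.singleton_append]
  split_ifs with h
  · simp only [h, hoff False (by simp [h])]
  · simp only [h, hoff True (by simp [h])]

end Trie

namespace Comp

variable {I : Type} {c : I → Input} {env F F' : I → Data}
  {𝒱 : (i : I) → Set (Set (Fin (c i).n))} {S : (i : I) → Set (Fin (c i).n)}

theorem mem_family (hS : Comp c env fun i => encodeSet (S i))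
    (h𝒱 : Comp c env fun i => encodeFamily (𝒱 i)) : Comp c env fun i => bit (S i ∈ 𝒱 i) := by
  classical
  refine (iter_vertex (c := c) (env := env) (st := fun i k => subtrie (𝒱 i) (S i) k) h𝒱 ?_).congr
    fun i => subtrie_n
  refine (((var.mem hS.up).weaken id fun j : WithVertex c =>
    subtrie (𝒱 j.1) (S j.1) j.2).ite_bit bound.snd bound.fst).congr fun j => ?_
  exact (subtrie_succ j.2).symm

theorem subtries_n (hS : Comp c env fun i => encodeSet (S i))
    (h𝒱 : Comp c env fun i => encodeFamily (𝒱 i)) :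
    Comp c env fun i => subtries (𝒱 i) (S i) (c i).n := by
  classical
  refine (iter_vertex (c := c) (env := env) (st := fun i k =>
    .cons (subtrie (𝒱 i) (S i) k) (subtries (𝒱 i) (S i) k)) (h𝒱.cons nil) ?_).snd
  refine ((((var.mem hS.up).weaken id fun j : WithVertex c =>
    Data.cons (subtrie (𝒱 j.1) (S j.1) j.2) (subtries (𝒱 j.1) (S j.1) j.2)).ite_bit
      bound.fst.snd bound.fst.fst).cons bound).congr fun j => ?_
  exact congrArg (Data.cons · _) (subtrie_succ j.2).symm

theorem insert_family (hS : Comp c env fun i => encodeSet (S i))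
    (h𝒱 : Comp c env fun i => encodeFamily (𝒱 i)) :
    Comp c env fun i => encodeFamily (insert (S i) (𝒱 i)) := by
  classical
  -- walk back along the path to `S`, with the number of remaining steps as a counter
  have key := iter (c := c) (env := env) (st := fun i k => .cons (unary ((c i).n - k))
    (.cons (subtries (𝒱 i) (S i) ((c i).n - k))
      (subtrie (insert (S i) (𝒱 i)) (S i) ((c i).n - k)))) ?_ ?_
  · exact key.snd.snd.congr fun i => by rw [Nat.sub_self]; rfl
  · refine (unary_n.cons ((subtries_n hS h𝒱).cons (nil.cons nil))).congr fun i => ?_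
    rw [Nat.sub_zero, subtrie_n]
    simp [bit]
  · set st : WithVertex c → Data := fun j => .cons (unary ((c j.1).n - j.2))
      (.cons (subtries (𝒱 j.1) (S j.1) ((c j.1).n - j.2))
        (subtrie (insert (S j.1) (𝒱 j.1)) (S j.1) ((c j.1).n - j.2))) with hst
    have hu : Comp (fun j : WithVertex c => c j.1) (fun j => .cons (env j.1) (st j))
        fun j => unary j.2.rev :=
      bound.fst.snd.congr fun j => unary_snd _
    have hmem := hu.mem (hS.weaken Sigma.fst st)
    have hstack : Comp (fun j : WithVertex c => c j.1) (fun j => .cons (env j.1) (st j))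
        fun j => .cons (subtrie (𝒱 j.1) (S j.1) j.2.rev) (subtries (𝒱 j.1) (S j.1) j.2.rev) :=
      bound.snd.fst.congr fun j => by
        have : (c j.1).n - j.2.1 = j.2.rev + 1 := by rw [Fin.val_rev]; have := j.2.2; omega
        change subtries _ _ _ = _
        rw [this]
        rfl
    refine (hu.cons (hstack.snd.cons (hmem.ite_bit (hstack.fst.fst.cons bound.snd.snd)
      (bound.snd.snd.cons hstack.fst.snd)))).congr fun j => ?_
    have h1 : (c j.1).n - (j.2.1 + 1) = j.2.rev := (Fin.val_rev _).symm
    have h2 : (c j.1).n - j.2.1 = j.2.rev + 1 := by rw [Fin.val_rev]; have := j.2.2; omega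
    rw [h1, subtrie_insert j.2.rev, ← h2]
    rfl

end Comp

/-! ### Searching the solution graph -/

section Search

variable {n : ℕ}

/-- The state of the search: the stack of the solutions that are still to be output, and the set of
all solutions found so far. -/
abbrev State (n : ℕ) : Type := List (Set (Fin n)) × Set (Set (Fin n))

/-- A state is stored as the pair of the linked list of the stack and the tree of the found
solutions. -/
noncomputable def encodeState (st : State n) : Data :=
  .cons (.ofList (st.1.map encodeSet)) (encodeFamily st.2)

variable {G : SimpleGraph (Fin n)} {W : Set (Fin n)}

open Classical in
/-- Reduce `U` to a solution, and record the solution if it is new. -/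
noncomputable def record (G : SimpleGraph (Fin n)) (W U : Set (Fin n)) (st : State n) : State n :=
  if IsInducedSteiner G W U ∧ greedy G U W ∉ st.2 then
    (greedy G U W :: st.1, insert (greedy G U W) st.2)
  else st

/-- Record what all candidates for `X` lead to. -/
noncomputable def expand (G : SimpleGraph (Fin n)) (W X : Set (Fin n)) (st : State n) : State n :=
  (List.finRange n).foldl (fun st v => (List.finRange n).foldl (fun st a =>
    (List.finRange n).foldl (fun st w => (List.finRange n).foldl (fun st u =>
      record G W (candidate G W X v a w u) st) st) st) st) st

theorem foldl_invariant {α β : Type*} {f : β → α → β} {P : β → Prop}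
    (hf : ∀ s a, P s → P (f s a)) (l : List α) : ∀ s, P s → P (l.foldl f s) := by
  induction l with
  | nil => exact fun _ h => h
  | cons a l ih => exact fun s h => ih _ (hf s a h)

theorem foldl_of_mem {α β : Type*} {f : β → α → β} {P : β → Prop}
    (hf : ∀ s a, P s → P (f s a)) {l : List α} {a : α} (ha : a ∈ l) (hPa : ∀ s, P (f s a)) :
    ∀ s, P (l.foldl f s) := by
  induction l with
  | nil => cases ha
  | cons b l ih =>
    intro s
    rcases List.mem_cons.1 ha with rfl | ha
    · exact foldl_invariant hf l _ (hPa s)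
    · exact ih ha _

theorem expand_invariant {P : State n → Prop} {X : Set (Fin n)}
    (h : ∀ U st, P st → P (record G W U st)) {st : State n} (hst : P st) : P (expand G W X st) :=
  foldl_invariant (fun st _ => foldl_invariant (fun st _ => foldl_invariant
    (fun st _ => foldl_invariant (fun st _ => h _ st) _ st) _ st) _ st) _ st hst

theorem mem_record_of_mem {U Z : Set (Fin n)} {st : State n} (h : Z ∈ st.2) :
    Z ∈ (record G W U st).2 := by
  unfold record
  split_ifs
  exacts [.inr h, h]

theorem greedy_mem_record {U : Set (Fin n)} (hU : IsInducedSteiner G W U) (st : State n) :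
    greedy G U W ∈ (record G W U st).2 := by
  unfold record
  split_ifs with h
  · exact .inl rfl
  · by_contra hn
    exact h ⟨hU, hn⟩

theorem greedy_mem_expand {X : Set (Fin n)} {v a w u : Fin n}
    (h : IsInducedSteiner G W (candidate G W X v a w u)) (st : State n) :
    greedy G (candidate G W X v a w u) W ∈ (expand G W X st).2 := by
  set Z := greedy G (candidate G W X v a w u) W
  have h4 : ∀ U (st : State n), Z ∈ st.2 → Z ∈ (record G W U st).2 :=
    fun _ _ => mem_record_of_mem
  have h3 : ∀ v a w (st : State n), Z ∈ st.2 → Z ∈ ((List.finRange n).foldl (fun st u =>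
      record G W (candidate G W X v a w u) st) st).2 := fun v a w =>
    foldl_invariant (P := fun st : State n => Z ∈ st.2) (fun st _ => h4 _ st) _
  have h2 := fun v a => foldl_invariant (P := fun st : State n => Z ∈ st.2)
    (fun st w => h3 v a w st) (List.finRange n)
  have h1 := fun v => foldl_invariant (P := fun st : State n => Z ∈ st.2)
    (fun st a => h2 v a st) (List.finRange n)
  exact foldl_of_mem (P := fun st : State n => Z ∈ st.2) (fun st v => h1 v st)
    (List.mem_finRange v) (foldl_of_mem (fun st a => h2 v a st) (List.mem_finRange a)
      (foldl_of_mem (fun st w => h3 v a w st) (List.mem_finRange w)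
        (foldl_of_mem (fun st u => h4 _ st) (List.mem_finRange u)
          fun st => greedy_mem_record h st))) st

/-- The solutions found so far are those in `O`, which have been output, and those on the stack. -/
structure Consistent (G : SimpleGraph (Fin n)) (W : Set (Fin n)) (O : List (Set (Fin n)))
    (st : State n) : Prop where
  mem_iff : ∀ X, X ∈ st.2 ↔ X ∈ O ++ st.1
  nodup : (O ++ st.1).Nodup
  minimal : ∀ X ∈ st.2, IsMinimalInducedSteiner G W X

theorem Consistent.record {O : List (Set (Fin n))} {st : State n} (h : Consistent G W O st)
    (U : Set (Fin n)) : Consistent G W O (record G W U st) := by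
  unfold SteinerEnum.record
  split_ifs with hU
  · refine ⟨fun X => ?_, ?_, ?_⟩
    · rw [Set.mem_insert_iff, h.mem_iff, List.mem_append, List.mem_append, List.mem_cons]
      tauto
    · rw [List.nodup_middle, List.nodup_cons]
      exact ⟨fun hm => hU.2 ((h.mem_iff _).2 hm), h.nodup⟩
    · rintro X (rfl | hX)
      exacts [(greedy_spec hU.1).2, h.minimal X hX]
  · exact h

end Search

namespace Comp

variable {I : Type} {c : I → Input} {env : I → Data}

theorem record {U : (i : I) → Set (Fin (c i).n)} {st : (i : I) → State (c i).n}
    (hU : Comp c env fun i => encodeSet (U i)) (hst : Comp c env fun i => encodeState (st i)) :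
    Comp c env fun i => encodeState (record (c i).graph (c i).terminals (U i) (st i)) := by
  classical
  have hstack : Comp c env fun i => Data.ofList ((st i).1.map encodeSet) := hst.fst
  have hfound : Comp c env fun i => encodeFamily (st i).2 := hst.snd
  have hZ := hU.greedy terminals
  refine (((terminals.isInducedSteiner hU).and (hZ.mem_family hfound).not).ite_bit
    ((hZ.cons hstack).cons (hZ.insert_family hfound)) hst).congr fun i => ?_
  unfold SteinerEnum.record
  split_ifs <;> rfl

theorem expand {X : (i : I) → Set (Fin (c i).n)} {st : (i : I) → State (c i).n}
    (hX : Comp c env fun i => encodeSet (X i)) (hst : Comp c env fun i => encodeState (st i)) :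
    Comp c env fun i => encodeState (expand (c i).graph (c i).terminals (X i) (st i)) := by
  refine fold (σ := fun i => State (c i).n) (enc := fun _ => encodeState) hst ?_
  refine fold (enc := fun _ => encodeState) state ?_
  refine fold (enc := fun _ => encodeState) state ?_
  refine fold (enc := fun _ => encodeState) state ?_
  exact record (candidate_comp hX.upState.upState.upState.upState varState.upState.upState.upState
    varState.upState.upState varState.upState varState) state

end Comp

/-! ### The enumeration program -/

section Program

/-- An expression for the initial state, in which the search starts from the whole graph. -/
theorem exists_initial : ∃ f : Fn, ∀ (c : Input) (d : Data),
    f.eval c d = encodeState (record c.graph c.terminals Set.univ ([], ∅)) := by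
  have h : Comp (fun i : Input × Data => i.1) (fun i => i.2) fun i =>
      encodeState (([], ∅) : State i.1.n) := by
    refine (Comp.nil.cons Comp.nil).congr fun i => congrArg (Data.cons .nil) ?_
    exact (trie_eq_nil fun l _ => by simp [IsBits]).symm
  have hU : Comp (fun i : Input × Data => i.1) (fun i => i.2) fun i =>
      encodeSet (Set.univ : Set (Fin i.1.n)) :=
    .setOf ((Comp.nil.cons Comp.nil).congr fun _ => (if_pos trivial).symm)
  obtain ⟨f, hf⟩ := hU.record h
  exact ⟨f, fun c d => hf (c, d)⟩

/-- An expression for the step that takes a solution off the stack and expands it. -/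
theorem exists_step : ∃ f : Fn, ∀ (c : Input) (X : Set (Fin c.n)) (L : List (Set (Fin c.n)))
    (𝒱 : Set (Set (Fin c.n))), f.eval c (encodeState (X :: L, 𝒱)) =
      encodeState (expand c.graph c.terminals X (L, 𝒱)) := by
  have hX : Comp (fun i : Σ c : Input, Set (Fin c.n) × State c.n => i.1)
      (fun i => encodeState (i.2.1 :: i.2.2.1, i.2.2.2)) fun i => encodeSet i.2.1 :=
    Comp.refl.fst.fst
  have hst : Comp (fun i : Σ c : Input, Set (Fin c.n) × State c.n => i.1)
      (fun i => encodeState (i.2.1 :: i.2.2.1, i.2.2.2)) fun i => encodeState i.2.2 :=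
    Comp.refl.fst.snd.cons Comp.refl.snd
  obtain ⟨f, hf⟩ := hX.expand hst
  exact ⟨f, fun c X L 𝒱 => hf ⟨c, X, L, 𝒱⟩⟩

/-- The main loop: the variable `2` holds the state and the variable `3` its stack. -/
def mainLoop (step : Fn) : Prog :=
  .loop 3 (.seq (.fst 3 3) (.seq (.emit 3) (.seq (step.compile 2) (.fst 3 2))))

/-- The whole enumeration program. -/
def mainProg (init step : Fn) : Prog :=
  .seq (init.compile 2) (.seq (.fst 3 2) (mainLoop step))

theorem DelayAtMost.of_length {D : ℕ} {tr : List Event} (h : tr.length ≤ D) : DelayAtMost D tr := by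
  rintro a b c rfl -
  simp only [List.length_append] at h
  omega

theorem DelayAtMost.append_out {D : ℕ} {tr l : List Event} {d : Data} (h : DelayAtMost D tr)
    (hl : l.length ≤ D) : DelayAtMost D (l ++ .out d :: tr) := by
  intro a b c habc hb
  have hout : ∀ b', b ≠ .out d :: b' := by rintro b' rfl; cases hb
  rw [List.append_assoc, List.append_eq_append_iff] at habc
  rcases habc with ⟨a', rfl, h'⟩ | ⟨c', rfl, h'⟩
  · cases a' with
    | nil =>
      cases b with
      | nil => exact Nat.zero_le D
      | cons e b =>
        obtain ⟨rfl, -⟩ := List.cons.inj h'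
        exact absurd rfl (hout b)
    | cons e a' =>
      obtain ⟨-, rfl⟩ := List.cons.inj h'
      exact h a' b c (List.append_assoc _ _ _).symm hb
  · rw [List.length_append] at hl
    rw [List.append_eq_append_iff] at h'
    rcases h' with ⟨b', rfl, h'⟩ | ⟨b', rfl, h'⟩
    · rw [List.length_append] at hl
      omega
    · cases b' with
      | nil => rw [List.append_nil]; omega
      | cons e b' =>
        obtain ⟨rfl, -⟩ := List.cons.inj h'
        simp [outputs] at hb

theorem size_ofList_le {k : ℕ} {l : List Data} (h : ∀ d ∈ l, d.size ≤ k) :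
    (Data.ofList l).size ≤ l.length * (k + 1) + 1 := by
  induction l with
  | nil => simp [Data.ofList, Data.size]
  | cons d l ih =>
    have h1 := h d (by simp)
    have h2 := ih fun d hd => h d (by simp [hd])
    simp only [Data.ofList, Data.size, List.length_cons, Nat.add_mul, Nat.one_mul]
    omega

theorem size_encodeSet_le {n : ℕ} (S : Set (Fin n)) : (encodeSet S).size ≤ n * 4 + 1 := by
  have := size_ofList_le (k := 3) (l := List.ofFn fun i => bit (i ∈ S)) ?_
  · rwa [List.length_ofFn] at this
  · intro d hd
    obtain ⟨i, rfl⟩ := (List.mem_ofFn' _ _).1 hd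
    change (bit (i ∈ S)).size ≤ 3
    unfold bit
    split_ifs <;> simp [Data.size]

theorem size_encodeGraph_le {n : ℕ} (G : SimpleGraph (Fin n)) :
    (encodeGraph G).size ≤ n * (n * 4 + 2) + 1 := by
  have := size_ofList_le (k := n * 4 + 1)
    (l := List.ofFn fun i => encodeSet {j | G.Adj i j}) ?_
  · rwa [List.length_ofFn] at this
  · intro d hd
    obtain ⟨i, rfl⟩ := (List.mem_ofFn' _ _).1 hd
    exact size_encodeSet_le _

theorem ofList_injective : Function.Injective Data.ofList := by
  intro l
  induction l with
  | nil => rintro (_ | ⟨d, l'⟩) h; exacts [rfl, by cases h]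
  | cons d l ih =>
    rintro (_ | ⟨d', l'⟩) h
    · cases h
    · have h' := Data.cons.inj h
      rw [h'.1, ih h'.2]

theorem encodeSet_injective {n : ℕ} : Function.Injective (encodeSet (n := n)) := by
  intro S T h
  have := List.ofFn_injective (ofList_injective h)
  ext v
  have hv : bit (v ∈ S) = bit (v ∈ T) := congrFun this v
  rw [← Comp.bit_ne_nil (p := v ∈ S), hv, Comp.bit_ne_nil]

theorem outputs_emit (k : ℕ) (d : Data) (l : List Event) :
    outputs (List.replicate k .tick ++ .out d :: l) = d :: outputs l := by
  induction k with
  | zero => rfl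
  | succ k ih => rw [List.replicate_succ, List.cons_append, outputs_tick, ih]

/-- The main loop outputs the solutions `O'` that are missing from `O`. What it finds is closed
under expansion. Each round takes time at most `T + 4 * n + 6`, and at most `4 * n + 3` units of it
precede the output. The number `B` bounds the time that has passed since the last output when a
round begins. -/
theorem mainLoop_spec {step : Fn} (c : Input)
    (hstep : ∀ (X : Set (Fin c.n)) (L : List (Set (Fin c.n))) (𝒱 : Set (Set (Fin c.n))),
      step.eval c (encodeState (X :: L, 𝒱)) =
        encodeState (expand c.graph c.terminals X (L, 𝒱)))
    {T D B : ℕ} (hT : step.time.eval c.n ≤ T) (hTB : T + 1 ≤ B) (hD : B + c.n * 4 + 3 ≤ D) (N : ℕ) :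
    ∀ (O : List (Set (Fin c.n))) (st : State c.n) (s : Store), 2 ^ c.n ≤ O.length + N →
      Consistent c.graph c.terminals O st →
      (∀ X Z : Solution c.graph c.terminals, Expands _ _ X Z → X.1 ∈ O → Z.1 ∈ st.2) →
      HasInput c s → s 2 = encodeState st → s 3 = (s 2).fst →
      ∃ (tr : List Event) (s' : Store) (O' : List (Set (Fin c.n))),
        Exec (mainLoop step) s tr s' ∧ outputs tr = O'.map encodeSet ∧ (O ++ O').Nodup ∧
        (∀ X ∈ O', IsMinimalInducedSteiner c.graph c.terminals X) ∧
        (∀ X ∈ st.2, X ∈ O ++ O') ∧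
        (∀ X Z : Solution c.graph c.terminals, Expands _ _ X Z → X.1 ∈ O ++ O' → Z.1 ∈ O ++ O') ∧
        tr.length ≤ O'.length * (T + c.n * 4 + 6) + 1 ∧
        ∀ l : List Event, l.length ≤ B → DelayAtMost D (l ++ tr) := by
  have hcard : ∀ O : List (Set (Fin c.n)), O.Nodup → O.length ≤ 2 ^ c.n := fun O hO => by
    classical
    simpa using hO.length_le_card
  have hdone : ∀ (O : List (Set (Fin c.n))) (st : State c.n) (s : Store), st.1 = [] →
      Consistent c.graph c.terminals O st →
      (∀ X Z : Solution c.graph c.terminals, Expands _ _ X Z → X.1 ∈ O → Z.1 ∈ st.2) →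
      s 2 = encodeState st → s 3 = (s 2).fst →
      ∃ (tr : List Event) (s' : Store) (O' : List (Set (Fin c.n))),
        Exec (mainLoop step) s tr s' ∧ outputs tr = O'.map encodeSet ∧ (O ++ O').Nodup ∧
        (∀ X ∈ O', IsMinimalInducedSteiner c.graph c.terminals X) ∧
        (∀ X ∈ st.2, X ∈ O ++ O') ∧
        (∀ X Z : Solution c.graph c.terminals, Expands _ _ X Z → X.1 ∈ O ++ O' → Z.1 ∈ O ++ O') ∧
        tr.length ≤ O'.length * (T + c.n * 4 + 6) + 1 ∧
        ∀ l : List Event, l.length ≤ B → DelayAtMost D (l ++ tr) := by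
    intro O st s hst hcons hcl h2 h3
    have hO : ∀ X, X ∈ st.2 ↔ X ∈ O := fun X => by rw [hcons.mem_iff, hst, List.append_nil]
    refine ⟨_, s, [], .loop_done ?_, rfl, ?_, by simp, ?_, ?_, by simp, fun l hl => ?_⟩
    · rw [h3, h2, encodeState, hst]; rfl
    · simpa [hst] using hcons.nodup
    · simpa using fun X => (hO X).1
    · simpa using fun X Z hXZ hX => (hO _).1 (hcl X Z hXZ hX)
    · exact .of_length (by rw [List.length_append, List.length_singleton]; omega)
  induction N with
  | zero =>
    intro O st s hN hcons hcl _ h2 h3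
    refine hdone O st s (List.eq_nil_of_length_eq_zero ?_) hcons hcl h2 h3
    have := hcard _ hcons.nodup
    rw [List.length_append] at this
    omega
  | succ N ih =>
    rintro O ⟨L, 𝒱⟩ s hN hcons hcl hin h2 h3
    cases L with
    | nil => exact hdone O _ s rfl hcons hcl h2 h3
    | cons X L =>
      -- one round: `X` moves from the stack to the output and is expanded
      set st' := expand c.graph c.terminals X (L, 𝒱) with hst'
      have hcons' : Consistent c.graph c.terminals (O ++ [X]) st' :=
        expand_invariant (fun U st h => h.record U)
          ⟨fun Y => by rw [hcons.mem_iff]; simp, by simpa using hcons.nodup, hcons.minimal⟩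
      have hmono : ∀ Y ∈ 𝒱, Y ∈ st'.2 := fun Y hY =>
        expand_invariant (P := fun st : State c.n => Y ∈ st.2)
          (fun U st h => mem_record_of_mem h) (st := (L, 𝒱)) hY
      have hcl' : ∀ Y Z : Solution c.graph c.terminals, Expands _ _ Y Z → Y.1 ∈ O ++ [X] →
          Z.1 ∈ st'.2 := by
        intro Y Z hYZ hY
        rcases List.mem_append.1 hY with hY | hY
        · exact hmono _ (hcl Y Z hYZ hY)
        · obtain ⟨v, a, w, u, hS, hZ⟩ := hYZ
          rw [List.mem_singleton.1 hY] at hS hZ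
          exact hZ ▸ greedy_mem_expand hS (L, 𝒱)
      have h3' : s 3 = .cons (encodeSet X) (.ofList (L.map encodeSet)) := by rw [h3, h2]; rfl
      set s₁ := Function.update s 3 (s 3).fst with hs₁
      have hs₁3 : s₁ 3 = encodeSet X := by rw [hs₁, Function.update_self, h3']; rfl
      obtain ⟨s₂, ⟨tr, htr, hout, hlen⟩, hs₂, hs₂'⟩ := step.runs c 2 s₁ le_rfl
        (hin.congr (Function.update_of_ne (by omega) _ _) (Function.update_of_ne (by omega) _ _))
      rw [hs₁, Function.update_of_ne (by omega), h2, hstep, ← hst'] at hs₂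
      set s₃ := Function.update s₂ 3 (s₂ 2).fst with hs₃
      have hs₃2 : s₃ 2 = encodeState st' := by rw [hs₃, Function.update_of_ne (by omega), hs₂]
      have hs₃in : HasInput c s₃ := hin.congr
        (by rw [hs₃, Function.update_of_ne (by omega), hs₂' 0 (by omega), hs₁,
          Function.update_of_ne (by omega)])
        (by rw [hs₃, Function.update_of_ne (by omega), hs₂' 1 (by omega), hs₁,
          Function.update_of_ne (by omega)])
      obtain ⟨tr', s', O', he, ho, hnd, hmin, hsub, hcl'', hlen', hdel⟩ := ih (O ++ [X]) st' s₃
        (by rw [List.length_append, List.length_singleton]; omega) hcons' hcl' hs₃in hs₃2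
        (by rw [hs₃2, hs₃, Function.update_self, hs₂])
      have happ : O ++ [X] ++ O' = O ++ X :: O' := by simp
      rw [happ] at hnd hsub hcl''
      have hsize := size_encodeSet_le X
      refine ⟨_, s', X :: O', .loop_step (by rw [h3']; exact Data.noConfusion)
        (.seq (.fst s 3 3) (.seq (.emit s₁ 3) (.seq htr (.fst s₂ 3 2)))) he, ?_, hnd, ?_,
        fun Y hY => hsub Y (hmono Y hY), hcl'', ?_, fun l hl => ?_⟩
      · rw [outputs_tick, List.append_assoc, List.singleton_append, outputs_tick,
          List.append_assoc, List.append_assoc, List.append_assoc, List.singleton_append,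
          outputs_emit, outputs_append, hout, hs₁3, List.nil_append, List.singleton_append,
          outputs_tick, ho, List.map_cons]
      · intro Y hY
        rcases List.mem_cons.1 hY with rfl | hY
        · exact hcons.minimal _ ((hcons.mem_iff _).2 (by simp))
        · exact hmin Y hY
      · simp only [List.length_cons, List.length_append, List.length_nil, List.length_replicate,
          hs₁3, Nat.add_mul, Nat.one_mul] at hlen' ⊢
        omega
      · have h1 := (hdel (tr ++ [.tick]) (by
          rw [List.length_append, List.length_singleton]; omega)).append_out
          (l := l ++ .tick :: .tick :: List.replicate (encodeSet X).size .tick) (d := encodeSet X)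
          (by simp only [List.length_append, List.length_cons, List.length_replicate]; omega)
        rw [hs₁3]
        simpa using h1

end Program

theorem exists_enumeration : ∃ (prog : Prog) (p q : Polynomial ℕ),
    ∀ (n : ℕ) (G : SimpleGraph (Fin n)) (W : Set (Fin n)), ClawFree G →
      EnumeratesWithin prog G W (p.eval n) (2 ^ n * q.eval n) := by
  obtain ⟨init, hinit⟩ := exists_initial
  obtain ⟨step, hstep⟩ := exists_step
  refine ⟨mainProg init step, init.time + step.time + .X * 4 + 5,
    .X * (.X * 4 + 2) + .X * 4 + init.time + (step.time + .X * 4 + 6) + 4, fun n G W hG => ?_⟩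
  set c : Input := ⟨n, G, W⟩ with hc
  set Ti := init.time.eval n with hTi
  set Te := step.time.eval n with hTe
  have hin : HasInput c (inputStore G W) := ⟨rfl, rfl⟩
  obtain ⟨s₁, ⟨tr₁, he₁, ho₁, hl₁⟩, hv₁, hs₁⟩ := init.runs c 2 _ le_rfl hin
  rw [hinit] at hv₁
  set st := record c.graph c.terminals Set.univ ([], ∅) with hst
  set s₂ := Function.update s₁ 3 (s₁ 2).fst with hs₂
  have hin₂ : HasInput c s₂ := hin.congr
    (by rw [hs₂, Function.update_of_ne (by omega), hs₁ 0 (by omega)])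
    (by rw [hs₂, Function.update_of_ne (by omega), hs₁ 1 (by omega)])
  have hcons : Consistent c.graph c.terminals [] st :=
    Consistent.record ⟨by simp, by simp, by simp⟩ _
  obtain ⟨tr, s', O, he, ho, hnd, hmin, hsub, hcl, hlen, hdel⟩ := mainLoop_spec c (hstep c)
    (T := Te) (B := Ti + Te + 1) (D := Ti + Te + n * 4 + 5) le_rfl (by omega)
    (by rw [hc]; dsimp only; omega) (2 ^ n) [] st s₂ (by simp [hc]) hcons (by simp) hin₂
    (by rw [hs₂, Function.update_of_ne (by omega), hv₁])
    (by rw [hs₂, Function.update_self, Function.update_of_ne (by omega)])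
  simp only [List.nil_append] at hnd hsub hcl
  have hout : outputs (tr₁ ++ ([.tick] ++ tr)) = O.map encodeSet := by
    rw [outputs_append, ho₁, List.nil_append, List.singleton_append, outputs_tick, ho]
  refine ⟨_, s', .seq he₁ (.seq (.fst s₁ 3 2) he), ?_, fun d => ?_, ?_, ?_⟩
  · rw [hout]
    exact hnd.map encodeSet_injective
  · rw [hout, List.mem_map]
    constructor
    · rintro ⟨X, hX, rfl⟩
      exact ⟨X, hmin X hX, rfl⟩
    · rintro ⟨X, hX, rfl⟩
      refine ⟨X, ?_, rfl⟩
      -- the search starts from a solution, from which `X` is reachable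
      have huniv := hX.1.mono (Set.subset_univ X)
      have hreach := expands_reroutes.reachable hG isMinimizer_greedy
        ⟨greedy G Set.univ W, (greedy_spec huniv).2⟩ ⟨X, hX⟩
      have hstart : greedy G Set.univ W ∈ O := hsub _ (greedy_mem_record huniv _)
      have key : ∀ Z : Solution G W, Relation.ReflTransGen (Expands G W)
          ⟨greedy G Set.univ W, (greedy_spec huniv).2⟩ Z → Z.1 ∈ O := fun Z hZ => by
        induction hZ with
        | refl => exact hstart
        | tail _ h ih => exact hcl _ _ h ih
      exact key _ hreach
  · have := hdel (tr₁ ++ [.tick]) (by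
      rw [List.length_append, List.length_singleton]
      have : tr₁.length ≤ Ti := hl₁
      omega)
    rw [List.append_assoc] at this
    simpa [hTi, hTe] using this
  · have hO : O.length ≤ 2 ^ n := by
      classical
      simpa using hnd.length_le_card
    have h1 : allocations (tr₁ ++ ([.tick] ++ tr)) ≤
        Ti + 1 + (O.length * (Te + n * 4 + 6) + 1) := by
      refine List.countP_le_length.trans ?_
      simp only [List.length_append, List.length_singleton]
      have : tr₁.length ≤ Ti := hl₁
      have : tr.length ≤ O.length * (Te + n * 4 + 6) + 1 := hlen
      omega
    have h2 := Nat.mul_le_mul_right (Te + n * 4 + 6) hO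
    have h3 := size_encodeGraph_le G
    have h4 := size_encodeSet_le W
    have h5 : n * (n * 4 + 2) + n * 4 + Ti + 4 ≤ 2 ^ n * (n * (n * 4 + 2) + n * 4 + Ti + 4) :=
      Nat.le_mul_of_pos_left _ (by positivity)
    have h6 : (Polynomial.X * (Polynomial.X * 4 + 2) + Polynomial.X * 4 + init.time +
        (step.time + Polynomial.X * 4 + 6) + 4 : Polynomial ℕ).eval n =
        (n * (n * 4 + 2) + n * 4 + Ti + 4) + (Te + n * 4 + 6) := by
      simp only [Polynomial.eval_add, Polynomial.eval_mul, Polynomial.eval_X,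
        Polynomial.eval_ofNat, ← hTi, ← hTe]
      ring
    rw [h6, Nat.mul_add, memoryUsed]
    omega

end SteinerEnum

theorem mainTheorem6 :
    (∃ (prog : SteinerEnum.Prog) (p q : Polynomial ℕ),
      ∀ (n : ℕ) (G : SimpleGraph (Fin n)) (W : Set (Fin n)), SteinerEnum.ClawFree G →
        SteinerEnum.EnumeratesWithin prog G W (p.eval n) (2 ^ n * q.eval n)) ∧
    (∀ (V : Type*) [Finite V] (G : SimpleGraph V) (W : Set V), SteinerEnum.ClawFree G →
      ∀ (μ : Set V → Set V → Set V) (π : Set V → V → Set V → Set V → V → Set V),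
        SteinerEnum.IsMinimizer G μ → SteinerEnum.IsPathSelector G W μ π →
        (∀ X Y : SteinerEnum.Solution G W, X ≠ Y →
          ∃ Z : SteinerEnum.Solution G W,
            Relation.ReflTransGen (SteinerEnum.Arc G W μ π) X Z ∧
              (Z.1 \ Y.1).ncard < (X.1 \ Y.1).ncard) ∧
        (∀ X Y : SteinerEnum.Solution G W,
          Relation.ReflTransGen (SteinerEnum.Arc G W μ π) X Y)) := by
  refine ⟨SteinerEnum.exists_enumeration, fun V _ G W hG μ π hμ hπ => ⟨?_, ?_⟩⟩
  · exact (SteinerEnum.arc_reroutes hμ hπ).progress hG hμ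
  · exact (SteinerEnum.arc_reroutes hμ hπ).reachable hG hμ
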